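/- **Setting.** Let $X$ be a compact smooth manifold with boundary, with a scattering metric $g=\frac{dx^2}{x^4}+\frac{h'}{x^2}$ near $\partial X$ ($x$ a boundary defining function), and let $h=h'|_{\partial X}$ be the induced Riemannian metric on $M=\partial X$. All notions below depend only on $(M,h)$, which may be any compact smooth manifold without boundary with a smooth Riemannian metric. Let $\mathcal C$ be a finite family of closed embedded submanifolds of $M$ with $M\in\mathcal C$, any two of which are disjoint or intersect cleanly in a member of $\mathcal C$. Assume that $\mathcal C$ is locally linearizable: each $p\in M$ has a smooth chart, centered at $p$, in which every $C\in\mathcal C$ with $p\in C$ is the intersection of a linear subspace with the image of the chart. Let $\lambda>0$. An interval may be open, closed or half-open, and derivatives at endpoints are one-sided. **Compressed bundles.** For $C\in\mathcal C$ let $C'=C\setminus\bigcup\{D\in\mathcal C: D\subsetneq C\}$. Let $\dot T^*M=\bigcup_{C\in\mathcal C}T^*_{C'}C$, with the projection $\pi_\partial:T^*M\to\dot T^*M$ restricting covectors at $p\in C'$ to $T_pC$, and with the quotient topology. Let $h(\zeta)=|\zeta|_h^2$ for $\zeta\in T^*M$, $S^*M=\{h=1\}$ and $\dot S^*M=\pi_\partial(S^*M)$.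 The scattering cotangent bundle over $\partial X$ is ${}^{sc}T^*_{\partial X}X=\mathbb R_\tau\times T^*M$ and its compressed version is $\mathbb R_\tau\times\dot T^*M$, with points written $(\tau,\xi'')$; $\pi=\mathrm{id}\times\pi_\partial$, and again the topology is the quotient topology. Let $$\Sigma=\{\tau^2+h=\lambda\},\qquad \dot\Sigma=\pi(\Sigma),\qquad R_\pm(\lambda)=\pi(\{\tau=\pm\sqrt\lambda,\ h=0\}),$$ and let ${}^{sc}H_g=2\tau\,\mathcal R-2h\,\partial_\tau+H_h$ be the rescaled Hamilton vector field of $g=\tau^2+h$ at $\partial X$, where $\mathcal R$ is the radial vector field on the fibres of $T^*M$ and $H_h$ is the Hamilton vector field of $h$ on $T^*M$. The tangential part of $\dot\Sigma$ (resp. of $\dot S^*M$) is the set of points with exactly one preimage in $\Sigma$ (resp. in $S^*M$); the normal part is the set of points with more than one. **Definitions.** A *generalized broken bicharacteristic* of $\Delta-\lambda$ is a continuous map $\gamma:I\to\dot\Sigma$, $I\subset\mathbb R$ an interval, such that 1. if $\gamma(t_0)$ is tangential with preimage $\tilde\xi_0\in\Sigma$, then $\frac{d}{dt}(F\circ\gamma)(t_0)={}^{sc}H_g(F\circ\pi)(\tilde\xi_0)$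 for every $F$ on $\mathbb R_\tau\times\dot T^*M$ with $F\circ\pi$ smooth; 2. if $\gamma(t_0)$ is normal and lies over $C'$, $C\in\mathcal C$, then there is $\varepsilon>0$ such that $\gamma(t)$ does not lie over $C'$ for $t\in I$, $0<|t-t_0|<\varepsilon$. A *generalized broken geodesic* of $h$, broken at $\mathcal C$, is a continuous map $\gamma_\partial:J\to\dot S^*M$, $J$ an interval, satisfying the same two conditions with $\Sigma,\pi,{}^{sc}H_g$ replaced by $S^*M,\pi_\partial,H_{\frac12h}$. **Proposition.** Let $\gamma:I\to\dot\Sigma$ be a generalized broken bicharacteristic of $\Delta-\lambda$ disjoint from $R_+(\lambda)\cup R_-(\lambda)$. For all $t_0\in I$, $s_0\in\mathbb R$ there is a function $S$ with $$\frac{dS}{dt}=2\bigl(\lambda-\tau(\gamma(t))^2\bigr)^{1/2}\ \text{ on } I,\qquad S(t_0)=s_0.$$ Every solution $S$ of this differential equation on $I$ is strictly increasing on $I$, and with $J=S(I)$ there are a constant $s_1$ with $J\subset(s_1,s_1+\pi)$ and a generalized broken geodesic $\gamma_\partial:J\to\dot S^*M$ of $h$, broken at $\mathcal C$, such that $\gamma\circ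 S^{-1}:J\to\dot\Sigma$ is given by $$\tau=\sqrt\lambda\,\cos(s-s_1),\qquad \xi''=\sqrt\lambda\,\sin(s-s_1)\,\gamma_\partial(s),\qquad s\in J.$$ If $I=\mathbb R$, then $J=(s_1,s_1+\pi)$, and the projection $c$ of $\gamma_\partial$ to $M$ is a curve of length $\pi$: it is differentiable at all but countably many $s\in J$, and $\int_{s_1}^{s_1+\pi}|c'(s)|_h\,ds=\pi$. -/

import Mathlib

open scoped Manifold ContDiff

universe u

noncomputable section

namespace BrokenBichar

/-! ### The cotangent bundle and the Riemannian metric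

`M` plays the role of the boundary at infinity `∂X`; it is a smooth manifold without boundary,
modelled on `ℝⁿ`, and `h` is a smooth Riemannian metric on it. -/

/-- The cotangent bundle `T*M`, with Mathlib's topology and smooth structure on the bundle of
continuous linear forms on the tangent spaces. -/
abbrev Cotangent (n : ℕ) (M : Type u) [TopologicalSpace M]
    [ChartedSpace (EuclideanSpace ℝ (Fin n)) M] [IsManifold (𝓡 n) ∞ M] : Type u :=
  Bundle.TotalSpace (EuclideanSpace ℝ (Fin n) →L[ℝ] ℝ)
    (fun p : M => TangentSpace (𝓡 n) p →L[ℝ] Bundle.Trivial M ℝ p)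

/-- The model with corners of the manifold `T*M`. -/
abbrev cotModel (n : ℕ) := (𝓡 n).prod 𝓘(ℝ, EuclideanSpace ℝ (Fin n) →L[ℝ] ℝ)

/-- Smooth Riemannian metrics on `M`. -/
abbrev Metric (n : ℕ) (M : Type u) [TopologicalSpace M]
    [ChartedSpace (EuclideanSpace ℝ (Fin n)) M] [IsManifold (𝓡 n) ∞ M] : Type u :=
  Bundle.ContMDiffRiemannianMetric (𝓡 n) ∞ (EuclideanSpace ℝ (Fin n))
    (fun p : M => TangentSpace (𝓡 n) p)

variable {n : ℕ} {M : Type u} [TopologicalSpace M]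
  [ChartedSpace (EuclideanSpace ℝ (Fin n)) M] [IsManifold (𝓡 n) ∞ M]

/-- The tangent vector `♯ζ` with `h(♯ζ, ·) = ζ` (see `inner_sharp`). -/
def sharp (h : Metric n M) (ζ : Cotangent n M) : TangentSpace (𝓡 n) ζ.proj :=
  (h.inner ζ.proj).inverse ζ.snd

/-- The metric function `h(ζ) = |ζ|²` on `T*M`: the squared length of a covector. -/
def metricFn (h : Metric n M) (ζ : Cotangent n M) : ℝ := ζ.snd (sharp h ζ)

/-- Multiplication of covectors by scalars. -/
def scale (r : ℝ) (ζ : Cotangent n M) : Cotangent n M := ⟨ζ.proj, r • ζ.snd⟩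

/-- The derivative `H_q f (ζ)` of `f` along the Hamilton vector field of `q` on `T*M`, that is
`∑ᵢ (∂q/∂μᵢ ∂f/∂yᵢ - ∂q/∂yᵢ ∂f/∂μᵢ)` in the canonical coordinates `(y, μ)` of `T*M` induced by
the preferred chart of `M` at the base point of `ζ`. -/
def hamilton (q f : Cotangent n M → ℝ) (ζ : Cotangent n M) : ℝ :=
  let φ := extChartAt (cotModel n) ζ
  let q' := fderiv ℝ (q ∘ φ.symm) (φ ζ)
  let f' := fderiv ℝ (f ∘ φ.symm) (φ ζ)
  ∑ i : Fin n,
    (q' (0, EuclideanSpace.proj i) * f' (EuclideanSpace.single i 1, 0)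
      - q' (EuclideanSpace.single i 1, 0) * f' (0, EuclideanSpace.proj i))

/-! ### The family `𝒞` -/

/-- `C` is a (not necessarily closed) embedded submanifold: near each of its points it is a linear
slice in a chart of the smooth atlas. -/
def IsSubmanifold (n : ℕ) {M : Type u} [TopologicalSpace M]
    [ChartedSpace (EuclideanSpace ℝ (Fin n)) M] (C : Set M) : Prop :=
  ∀ p ∈ C, ∃ e ∈ IsManifold.maximalAtlas (𝓡 n) ∞ M, p ∈ e.source ∧
    ∃ L : Submodule ℝ (EuclideanSpace ℝ (Fin n)), e '' (C ∩ e.source) = (L : Set _) ∩ e.target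

/-- The tangent space `T_p C` of a closed embedded submanifold `C` at `p ∈ C`, as a subspace of
`T_p M`: the vectors annihilated by the differentials of all smooth functions vanishing on `C`. -/
def tangentSub (n : ℕ) {M : Type u} [TopologicalSpace M]
    [ChartedSpace (EuclideanSpace ℝ (Fin n)) M] (C : Set M) (p : M) :
    Submodule ℝ (TangentSpace (𝓡 n) p) where
  carrier := {v | ∀ f : M → ℝ, ContMDiff (𝓡 n) 𝓘(ℝ, ℝ) ∞ f → (∀ q ∈ C, f q = 0) →
    mfderiv (𝓡 n) 𝓘(ℝ, ℝ) f p v = 0}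
  add_mem' := by
    intro v w hv hw f hf h0
    rw [map_add, hv f hf h0, hw f hf h0, add_zero]
  zero_mem' := by
    intro f _ _
    exact map_zero _
  smul_mem' := by
    intro c v hv f hf h0
    rw [map_smul, hv f hf h0, smul_zero]

/-- `𝒞` is a many-body family in `M`: a finite family of closed embedded submanifolds containing
`M`, any two of which are disjoint or intersect cleanly in a member of the family. -/
structure IsManyBodyFamily (n : ℕ) {M : Type u} [TopologicalSpace M]
    [ChartedSpace (EuclideanSpace ℝ (Fin n)) M] (𝒞 : Set (Set M)) : Prop where
  finite : 𝒞.Finite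
  univ_mem : Set.univ ∈ 𝒞
  isClosed : ∀ C ∈ 𝒞, IsClosed C
  isSubmanifold : ∀ C ∈ 𝒞, IsSubmanifold n C
  inter_mem : ∀ C ∈ 𝒞, ∀ D ∈ 𝒞, (C ∩ D).Nonempty → C ∩ D ∈ 𝒞
  clean : ∀ C ∈ 𝒞, ∀ D ∈ 𝒞, ∀ p ∈ C ∩ D,
    tangentSub n (C ∩ D) p = tangentSub n C p ⊓ tangentSub n D p

/-- `𝒞` is locally linearizable: each point `p` has a chart in which all the members of `𝒞` through
`p` are linear subspaces. -/
def LocallyLinearizable (n : ℕ) {M : Type u} [TopologicalSpace M]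
    [ChartedSpace (EuclideanSpace ℝ (Fin n)) M] (𝒞 : Set (Set M)) : Prop :=
  ∀ p : M, ∃ e ∈ IsManifold.maximalAtlas (𝓡 n) ∞ M, p ∈ e.source ∧ e p = 0 ∧
    ∀ C ∈ 𝒞, p ∈ C → ∃ L : Submodule ℝ (EuclideanSpace ℝ (Fin n)),
      e '' (C ∩ e.source) = (L : Set _) ∩ e.target

/-- The regular part `C' = C \ ⋃ {D ∈ 𝒞 : D ⊊ C}`. -/
def regularPart (𝒞 : Set (Set M)) (C : Set M) : Set M := C \ ⋃₀ {D ∈ 𝒞 | D ⊂ C}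

/-- The smallest member of `𝒞` containing `p`, i.e. the `C ∈ 𝒞` with `p ∈ C'`
(see `mem_regularPart_iff`). -/
def minimalMember (𝒞 : Set (Set M)) (p : M) : Set M := ⋂₀ {C ∈ 𝒞 | p ∈ C}

/-! ### Compressed bundles -/

/-- The compressed cotangent bundle `Ṫ*M = ⋃_C T*_{C'} C`: a point consists of `p ∈ M` and a
linear form on `T_p C`, where `C` is the member of `𝒞` with `p ∈ C'`. -/
@[ext] structure DotCotangent (n : ℕ) {M : Type u} [TopologicalSpace M]
    [ChartedSpace (EuclideanSpace ℝ (Fin n)) M] (𝒞 : Set (Set M)) where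
  base : M
  covec : Module.Dual ℝ (tangentSub n (minimalMember 𝒞 base) base)

variable {𝒞 : Set (Set M)}

/-- The projection `π_∂ : T*M → Ṫ*M`, restriction of covectors at `p ∈ C'` to `T_p C`. (In terms
of the embedding of `T*C` into `T*M` given by the metric, this is the orthogonal projection.) -/
def piBdry (𝒞 : Set (Set M)) (ζ : Cotangent n M) : DotCotangent n 𝒞 :=
  ⟨ζ.proj, (ζ.snd : TangentSpace (𝓡 n) ζ.proj →ₗ[ℝ] ℝ) ∘ₗ
    (tangentSub n (minimalMember 𝒞 ζ.proj) ζ.proj).subtype⟩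

/-- `Ṫ*M` carries the topology coinduced by `π_∂`. -/
instance : TopologicalSpace (DotCotangent n 𝒞) :=
  TopologicalSpace.coinduced (piBdry 𝒞) inferInstance

/-- The fibrewise action of the reals on `Ṫ*M`. -/
instance : SMul ℝ (DotCotangent n 𝒞) := ⟨fun r ζ => ⟨ζ.base, r • ζ.covec⟩⟩

/-- The scattering cotangent bundle `ℝ_τ × T*M` of `X` over `∂X = M`. -/
abbrev ScCotangent (n : ℕ) (M : Type u) [TopologicalSpace M]
    [ChartedSpace (EuclideanSpace ℝ (Fin n)) M] [IsManifold (𝓡 n) ∞ M] : Type u :=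
  ℝ × Cotangent n M

/-- The compressed scattering cotangent bundle `⋃_C sc-T*_{C'}(C; X) = ℝ_τ × Ṫ*M`; its points are
written `(τ, ξ'')`. -/
@[ext] structure ScDot (n : ℕ) {M : Type u} [TopologicalSpace M]
    [ChartedSpace (EuclideanSpace ℝ (Fin n)) M] (𝒞 : Set (Set M)) where
  tau : ℝ
  fib : DotCotangent n 𝒞

/-- The projection `π` from the scattering cotangent bundle to the compressed one. -/
def piSc (𝒞 : Set (Set M)) (ξ : ScCotangent n M) : ScDot n 𝒞 := ⟨ξ.1, piBdry 𝒞 ξ.2⟩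

/-- The compressed scattering cotangent bundle carries the topology coinduced by `π`. -/
instance : TopologicalSpace (ScDot n 𝒞) :=
  TopologicalSpace.coinduced (piSc 𝒞) inferInstance

/-! ### Generalized broken bicharacteristics of `Δ - lam` -/

/-- The characteristic variety `Σ = {τ² + h = lam}` of `Δ - lam`. -/
def charSet (h : Metric n M) (lam : ℝ) : Set (ScCotangent n M) :=
  {ξ | ξ.1 ^ 2 + metricFn h ξ.2 - lam = 0}

/-- The compressed characteristic set, the image of `Σ` under `π`. -/
def dotChar (𝒞 : Set (Set M)) (h : Metric n M) (lam : ℝ) : Set (ScDot n 𝒞) :=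
  piSc 𝒞 '' charSet h lam

/-- The normal part `Σ_n`: more than one point of `Σ` lies above `ξ`. -/
def charNormal (𝒞 : Set (Set M)) (h : Metric n M) (lam : ℝ) : Set (ScDot n 𝒞) :=
  {ξ | {ξ' | ξ' ∈ charSet h lam ∧ piSc 𝒞 ξ' = ξ}.Nontrivial}

/-- The tangential part `Σ_t`: exactly one point of `Σ` lies above `ξ`. -/
def charTangential (𝒞 : Set (Set M)) (h : Metric n M) (lam : ℝ) : Set (ScDot n 𝒞) :=
  {ξ | ∃! ξ', ξ' ∈ charSet h lam ∧ piSc 𝒞 ξ' = ξ}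

/-- The radial set `R_+`. -/
def radialPlus (𝒞 : Set (Set M)) (h : Metric n M) (lam : ℝ) : Set (ScDot n 𝒞) :=
  piSc 𝒞 '' {ξ | ξ.1 = √lam ∧ metricFn h ξ.2 = 0}

/-- The radial set `R_-`. -/
def radialMinus (𝒞 : Set (Set M)) (h : Metric n M) (lam : ℝ) : Set (ScDot n 𝒞) :=
  piSc 𝒞 '' {ξ | ξ.1 = -√lam ∧ metricFn h ξ.2 = 0}

/-- The derivative of `f` at `ξ` along the rescaled Hamilton vector field of `g = τ² + h`
restricted to the boundary, `2τ (μ·∂_μ) - 2h ∂_τ + H_h`, where `μ·∂_μ` is the radial vector field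
on the fibres of `T*M`. -/
def scHamilton (h : Metric n M) (f : ScCotangent n M → ℝ) (ξ : ScCotangent n M) : ℝ :=
  2 * ξ.1 * deriv (fun r : ℝ => f (ξ.1, scale r ξ.2)) 1
    - 2 * metricFn h ξ.2 * deriv (fun σ : ℝ => f (σ, ξ.2)) ξ.1
    + hamilton (metricFn h) (fun ζ => f (ξ.1, ζ)) ξ.2

/-- A generalized broken bicharacteristic of `Δ - lam` on the interval `I`. Since `π` is surjective,
`π`-invariant smooth functions `f` are those of the form `f = F ∘ π`, and then `f_π = F`. -/
structure IsBrokenBichar (𝒞 : Set (Set M)) (h : Metric n M) (lam : ℝ) (I : Set ℝ)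
    (γ : ℝ → ScDot n 𝒞) : Prop where
  interval : I.OrdConnected
  mapsTo : Set.MapsTo γ I (dotChar 𝒞 h lam)
  continuousOn : ContinuousOn γ I
  tangential : ∀ t ∈ I, γ t ∈ charTangential 𝒞 h lam →
    ∀ F : ScDot n 𝒞 → ℝ,
      ContMDiff (𝓘(ℝ, ℝ).prod (cotModel n)) 𝓘(ℝ, ℝ) ∞ (fun ξ : ScCotangent n M => F (piSc 𝒞 ξ)) →
      ∀ ξ ∈ charSet h lam, piSc 𝒞 ξ = γ t →
        HasDerivWithinAt (fun t' => F (γ t')) (scHamilton h (fun ξ' => F (piSc 𝒞 ξ')) ξ) I t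
  normal : ∀ t ∈ I, γ t ∈ charNormal 𝒞 h lam →
    ∀ C ∈ 𝒞, (γ t).fib.base ∈ regularPart 𝒞 C →
      ∃ ε > 0, ∀ t' ∈ I, 0 < |t' - t| → |t' - t| < ε → (γ t').fib.base ∉ regularPart 𝒞 C

/-! ### Generalized broken geodesics -/

/-- The unit cosphere bundle `S*M`. -/
def cosphere (h : Metric n M) : Set (Cotangent n M) := {ζ | metricFn h ζ = 1}

/-- The compressed cosphere bundle `Ṡ*M = π_∂(S*M)`. -/
def dotCosphere (𝒞 : Set (Set M)) (h : Metric n M) : Set (DotCotangent n 𝒞) :=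
  piBdry 𝒞 '' cosphere h

/-- The normal part of `Ṡ*M`. -/
def cosphereNormal (𝒞 : Set (Set M)) (h : Metric n M) : Set (DotCotangent n 𝒞) :=
  {ζ | {ζ' | ζ' ∈ cosphere h ∧ piBdry 𝒞 ζ' = ζ}.Nontrivial}

/-- The tangential part of `Ṡ*M`. -/
def cosphereTangential (𝒞 : Set (Set M)) (h : Metric n M) : Set (DotCotangent n 𝒞) :=
  {ζ | ∃! ζ', ζ' ∈ cosphere h ∧ piBdry 𝒞 ζ' = ζ}

/-- A generalized broken geodesic of `h`, broken at `𝒞`, on the interval `J`. As above,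
`π_∂`-invariant functions are those of the form `F ∘ π_∂`. -/
structure IsBrokenGeodesic (𝒞 : Set (Set M)) (h : Metric n M) (J : Set ℝ)
    (γ : ℝ → DotCotangent n 𝒞) : Prop where
  interval : J.OrdConnected
  mapsTo : Set.MapsTo γ J (dotCosphere 𝒞 h)
  continuousOn : ContinuousOn γ J
  tangential : ∀ s ∈ J, γ s ∈ cosphereTangential 𝒞 h →
    ∀ F : DotCotangent n 𝒞 → ℝ,
      ContMDiff (cotModel n) 𝓘(ℝ, ℝ) ∞ (fun ζ : Cotangent n M => F (piBdry 𝒞 ζ)) →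
      ∀ ζ ∈ cosphere h, piBdry 𝒞 ζ = γ s →
        HasDerivWithinAt (fun s' => F (γ s'))
          (hamilton (fun ζ' => metricFn h ζ' / 2) (fun ζ' => F (piBdry 𝒞 ζ')) ζ) J s
  normal : ∀ s ∈ J, γ s ∈ cosphereNormal 𝒞 h →
    ∀ C ∈ 𝒞, (γ s).base ∈ regularPart 𝒞 C →
      ∃ ε > 0, ∀ s' ∈ J, 0 < |s' - s| → |s' - s| < ε → (γ s').base ∉ regularPart 𝒞 C

/-- The velocity of a curve in `M`. -/
def velocity (c : ℝ → M) (s : ℝ) : TangentSpace (𝓡 n) (c s) :=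
  mfderiv 𝓘(ℝ, ℝ) (𝓡 n) c s (1 : ℝ)

/-- The length of a curve on the interval `(a, b)` with respect to `h`: the integral of its speed.
It is only applied to curves that are continuous and have a velocity at all but countably many
parameters. -/
def curveLength (h : Metric n M) (c : ℝ → M) (a b : ℝ) : ENNReal :=
  ∫⁻ s in Set.Ioo a b,
    ENNReal.ofReal (√(h.inner (c s) (velocity (n := n) c s) (velocity (n := n) c s)))

/-- The function `S` reparametrizing `γ`: `dS/dt = 2 (lam - τ(γ(t))²)^{1/2}` on `I`. -/
def IsReparam (lam : ℝ) (I : Set ℝ) (γ : ℝ → ScDot n 𝒞) (S : ℝ → ℝ) : Prop :=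
  ∀ t ∈ I, HasDerivWithinAt S (2 * √(lam - (γ t).tau ^ 2)) I t

/-! ### Consistency of the definitions -/

theorem apply_inverse_of_pos {V : Type} [NormedAddCommGroup V] [InnerProductSpace ℝ V]
    [FiniteDimensional ℝ V] (B : V →L[ℝ] V →L[ℝ] ℝ) (hB : ∀ v, v ≠ 0 → 0 < B v v)
    (l : V →L[ℝ] ℝ) : B (B.inverse l) = l := by
  have hinj : Function.Injective (B : V →ₗ[ℝ] V →L[ℝ] ℝ) := by
    rw [injective_iff_map_eq_zero]
    intro v hv
    by_contra h0
    have h1 := hB v h0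
    have h2 : B v = 0 := hv
    rw [h2] at h1
    simp at h1
  have hdim : Module.finrank ℝ V = Module.finrank ℝ (V →L[ℝ] ℝ) :=
    LinearEquiv.finrank_eq (InnerProductSpace.toDual ℝ V).toLinearEquiv
  let e := (LinearEquiv.ofInjectiveOfFinrankEq (B : V →ₗ[ℝ] V →L[ℝ] ℝ) hinj
    hdim).toContinuousLinearEquiv
  have he : (e : V →L[ℝ] V →L[ℝ] ℝ) = B := by
    ext v w
    rfl
  rw [← he, ContinuousLinearMap.inverse_equiv]
  exact e.apply_symm_apply l

theorem inner_sharp (h : Metric n M) (ζ : Cotangent n M) :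
    h.inner ζ.proj (sharp h ζ) = ζ.snd :=
  apply_inverse_of_pos (V := EuclideanSpace ℝ (Fin n)) (h.inner ζ.proj) (h.pos ζ.proj) ζ.snd

theorem minimalMember_mem (h𝒞 : IsManyBodyFamily n 𝒞) (p : M) : minimalMember 𝒞 p ∈ 𝒞 := by
  have key : ∀ s : Set (Set M), s.Finite → s ⊆ {C ∈ 𝒞 | p ∈ C} → ⋂₀ s ∈ 𝒞 := by
    intro s hs
    induction s, hs using Set.Finite.induction_on with
    | empty => intro _; simpa using h𝒞.univ_mem
    | @insert C t _ _ ih =>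
      intro hsub
      rw [Set.sInter_insert]
      have ht : t ⊆ {C ∈ 𝒞 | p ∈ C} := fun D hD => hsub (Set.mem_insert_of_mem _ hD)
      have hC := hsub (Set.mem_insert C t)
      exact h𝒞.inter_mem C hC.1 _ (ih ht) ⟨p, hC.2, fun D hD => (ht hD).2⟩
  exact key _ (h𝒞.finite.subset fun C hC => hC.1) subset_rfl

theorem mem_regularPart_iff (h𝒞 : IsManyBodyFamily n 𝒞) {C : Set M} (hC : C ∈ 𝒞) (p : M) :
    p ∈ regularPart 𝒞 C ↔ minimalMember 𝒞 p = C := by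
  have hp : p ∈ minimalMember 𝒞 p := fun D hD => hD.2
  constructor
  · rintro ⟨hpC, hn⟩
    have hsub : minimalMember 𝒞 p ⊆ C := fun q hq => hq C ⟨hC, hpC⟩
    by_contra hne
    exact hn ⟨minimalMember 𝒞 p, ⟨minimalMember_mem h𝒞 p, hsub.ssubset_of_ne hne⟩, hp⟩
  · rintro rfl
    refine ⟨hp, ?_⟩
    rintro ⟨D, ⟨hD, hlt⟩, hpD⟩
    exact hlt.2 fun q hq => hq D ⟨hD, hpD⟩

theorem piBdry_surjective (𝒞 : Set (Set M)) :
    Function.Surjective (piBdry 𝒞 : Cotangent n M → DotCotangent n 𝒞) := by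
  rintro ⟨p, l⟩
  have aux : ∀ (W : Submodule ℝ (EuclideanSpace ℝ (Fin n))) (l : Module.Dual ℝ W),
      ∃ ζ : EuclideanSpace ℝ (Fin n) →L[ℝ] ℝ,
        (ζ : EuclideanSpace ℝ (Fin n) →ₗ[ℝ] ℝ) ∘ₗ W.subtype = l := by
    intro W l
    obtain ⟨g, hg⟩ := LinearMap.exists_extend l
    exact ⟨LinearMap.toContinuousLinearMap g, hg⟩
  obtain ⟨ζ, hζ⟩ := aux (tangentSub n (minimalMember 𝒞 p) p) l
  exact ⟨⟨p, ζ⟩, congrArg (DotCotangent.mk p) hζ⟩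

theorem piSc_surjective (𝒞 : Set (Set M)) :
    Function.Surjective (piSc 𝒞 : ScCotangent n M → ScDot n 𝒞) := by
  rintro ⟨τ, ζ⟩
  obtain ⟨ζ', rfl⟩ := piBdry_surjective 𝒞 ζ
  exact ⟨(τ, ζ'), rfl⟩

end BrokenBichar

end

/-!
The variable `τ` decouples from the motion in `M`. At a tangential point the definition of a broken
bicharacteristic, tested on `F = τ`, gives `τ' = -2 h = -2 (lam - τ²)`, because `h = lam - τ²` on
the characteristic set. A normal point over `C'` is isolated among the points over `C'`, so normal
parameters are countable (`countable_of_leaves_regularPart`). A continuous function whose derivative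
off a countable set is given by a continuous function has that derivative everywhere
(`hasDerivWithinAt_of_off_countable`), so the equation for `τ` holds on all of `I`, whatever happens
at the breaks. Away from the radial sets `|τ| < √lam`, and the angle `θ = arccos (τ / √lam)` then
satisfies `θ' = 2 (lam - τ²)^{1/2}`. Hence every reparametrization `S` differs from `θ` by a
constant `s₁`, which gives `τ = √lam cos (S - s₁)` and `(lam - τ²)^{1/2} = √lam sin (S - s₁)`.

The curve `γ_∂` is the fibre variable of `γ` multiplied by `(lam - τ²)^{-1/2}`, as a function of
`s = S(t)`. Multiplication by this positive factor is a bijection between the preimages of a point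
in the characteristic set and those of its image in the cosphere bundle, so tangential and normal
points correspond. For a test function on `Ṫ*M` evaluated on the normalized covector, the radial
term and the `∂_τ` term of the rescaled Hamilton field cancel, and the remaining term is
`2 (lam - τ²)^{1/2}` times the geodesic field (`scHamilton_comp_rescale`); the factor is exactly
`dS/dt`. The homogeneity used there is `hamilton_comp_scale`.

When `I = ℝ`, the function `log ((√lam - τ) / (√lam + τ))` is affine in `t` with positive slope, so
`τ` takes all values in `(-√lam, √lam)` and `J` is the whole interval `(s₁, s₁ + π)`. At a
tangential parameter with preimage `ζ` the geodesic Hamilton field projects to the vector `♯ζ` of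
length one (`hamilton_comp_proj`). Hence the base curve has unit speed off a countable set, and its
length is the length `π` of the parameter interval (`IsBrokenGeodesic.curveLength_eq`).
-/

noncomputable section

namespace BrokenBichar

open Bundle Filter Topology

variable {n : ℕ} {M : Type u} [TopologicalSpace M]
  [ChartedSpace (EuclideanSpace ℝ (Fin n)) M] [IsManifold (𝓡 n) ∞ M]
variable {𝒞 : Set (Set M)}

/-! ### Fibre scalings in canonical coordinates -/

/-- The inverse of a chart of `T*M` in terms of a chart of `M` and the induced frame of the tangent
bundle. The formula holds at all points of the model space, also outside the target of the
chart. -/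
lemma extChartAt_symm_eq (ζ : Cotangent n M) (y : EuclideanSpace ℝ (Fin n))
    (ν : EuclideanSpace ℝ (Fin n) →L[ℝ] ℝ) :
    (extChartAt (cotModel n) ζ).symm (y, ν) =
      (⟨(extChartAt (𝓡 n) ζ.proj).symm y, ν ∘L (trivializationAt (EuclideanSpace ℝ (Fin n))
        (TangentSpace (𝓡 n)) ζ.proj).continuousLinearMapAt ℝ
          ((extChartAt (𝓡 n) ζ.proj).symm y)⟩ : Cotangent n M) := by
  rw [FiberBundle.extChartAt]
  have h := fun p => Bundle.Trivial.symmL_trivialization ℝ M ℝ p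
  change (⟨(extChartAt (𝓡 n) ζ.proj).symm y, ((Bundle.Trivial.trivialization M ℝ).symmL ℝ _).comp
    (ν ∘L (trivializationAt (EuclideanSpace ℝ (Fin n)) (TangentSpace (𝓡 n))
      ζ.proj).continuousLinearMapAt ℝ ((extChartAt (𝓡 n) ζ.proj).symm y))⟩ : Cotangent n M) = _
  rw [h]
  rfl

lemma trivializationAt_cotangent_apply (p : M) (ζ : Cotangent n M) :
    trivializationAt (EuclideanSpace ℝ (Fin n) →L[ℝ] ℝ)
      (fun p : M => TangentSpace (𝓡 n) p →L[ℝ] Bundle.Trivial M ℝ p) p ζ =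
      (ζ.proj, ζ.snd ∘L (trivializationAt (EuclideanSpace ℝ (Fin n))
        (TangentSpace (𝓡 n)) p).symmL ℝ ζ.proj) := by
  rw [hom_trivializationAt_apply]
  unfold ContinuousLinearMap.inCoordinates
  have h := fun p => Bundle.Trivial.continuousLinearMapAt_trivialization ℝ M ℝ p
  change (ζ.proj, ((Bundle.Trivial.trivialization M ℝ).continuousLinearMapAt ℝ ζ.proj).comp _) = _
  rw [h]
  rfl

lemma extChartAt_eq (ζ ζ' : Cotangent n M) :
    extChartAt (cotModel n) ζ ζ' =
      (extChartAt (𝓡 n) ζ.proj ζ'.proj, ζ'.snd ∘L (trivializationAt (EuclideanSpace ℝ (Fin n))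
        (TangentSpace (𝓡 n)) ζ.proj).symmL ℝ ζ'.proj) := by
  rw [FiberBundle.extChartAt]
  have := trivializationAt_cotangent_apply ζ.proj ζ'
  simp [this]

/-- The preferred chart of `T*M` depends only on the base point. -/
lemma extChartAt_scale (r : ℝ) (ζ : Cotangent n M) :
    extChartAt (cotModel n) (scale r ζ) = extChartAt (cotModel n) ζ := by
  rw [FiberBundle.extChartAt, FiberBundle.extChartAt]
  rfl

/-- Scaling is smooth jointly in the factor and the covector. -/
lemma contMDiff_scale :
    ContMDiff (𝓘(ℝ, ℝ).prod (cotModel n)) (cotModel n) ∞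
      (fun ξ : ScCotangent n M => scale ξ.1 ξ.2) := by
  intro ξ
  have h2 := (contMDiffAt_snd (I := 𝓘(ℝ, ℝ)) (J := cotModel n) (n := ∞) (p := ξ))
  rw [contMDiffAt_totalSpace] at h2 ⊢
  refine ⟨h2.1, ?_⟩
  have h1 := (contMDiffAt_fst (I := 𝓘(ℝ, ℝ)) (J := cotModel n) (n := ∞) (p := ξ))
  refine (h1.smul h2.2).congr_of_eventuallyEq (Filter.Eventually.of_forall fun η => ?_)
  simp only [trivializationAt_cotangent_apply]
  rfl


lemma metricFn_scale (h : Metric n M) (r : ℝ) (ζ : Cotangent n M) :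
    metricFn h (scale r ζ) = r ^ 2 * metricFn h ζ := by
  have h1 : sharp h (scale r ζ) = r • sharp h ζ := map_smul (h.inner ζ.proj).inverse r ζ.snd
  unfold metricFn
  rw [h1]
  change r * ζ.snd (r • sharp h ζ) = _
  rw [ζ.snd.map_smul]
  change r * (r * ζ.snd (sharp h ζ)) = _
  ring

lemma scale_scale (r s : ℝ) (ζ : Cotangent n M) : scale r (scale s ζ) = scale (r * s) ζ := by
  unfold scale
  rw [smul_smul]

lemma scale_one (ζ : Cotangent n M) : scale 1 ζ = ζ := by
  unfold scale
  rw [one_smul]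

lemma metricFn_nonneg (h : Metric n M) (ζ : Cotangent n M) : 0 ≤ metricFn h ζ := by
  have h1 : metricFn h ζ = h.inner ζ.proj (sharp h ζ) (sharp h ζ) := by
    rw [inner_sharp]; rfl
  rw [h1]
  by_cases h0 : sharp h ζ = 0
  · rw [h0]; simp
  · exact (h.pos _ _ h0).le

/-- The bracket with a function of degree two in the fibres is of degree `-1` under the
fibre scalings, which multiply the symplectic form by the scaling factor. -/
lemma hamilton_comp_scale {q : Cotangent n M → ℝ} {c : ℝ} (hc : c ≠ 0)
    (hq : ∀ ζ, q (scale c ζ) = c ^ 2 * q ζ) (u : Cotangent n M → ℝ) (ζ : Cotangent n M) :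
    hamilton q (fun ζ' => u (scale c ζ')) ζ = c⁻¹ * hamilton q u (scale c ζ) := by
  unfold hamilton
  simp only [extChartAt_scale]
  set φ := extChartAt (cotModel n) ζ with hφ
  let L : (EuclideanSpace ℝ (Fin n) × (EuclideanSpace ℝ (Fin n) →L[ℝ] ℝ)) ≃L[ℝ]
      (EuclideanSpace ℝ (Fin n) × (EuclideanSpace ℝ (Fin n) →L[ℝ] ℝ)) :=
    (ContinuousLinearEquiv.refl ℝ _).prodCongr
      (ContinuousLinearEquiv.smulLeft (Units.mk0 c hc))
  have hL : ∀ y ν, L (y, ν) = (y, c • ν) := fun y ν => rfl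
  have hsymm : ∀ x, φ.symm (L x) = scale c (φ.symm x) := by
    rintro ⟨y, ν⟩
    rw [hL, hφ, extChartAt_symm_eq, extChartAt_symm_eq]
    rfl
  have hφL : φ (scale c ζ) = L (φ ζ) := by
    rw [hφ, extChartAt_eq, extChartAt_eq, hL]
    rfl
  have hu : fderiv ℝ ((fun ζ' => u (scale c ζ')) ∘ φ.symm) (φ ζ) =
      (fderiv ℝ (u ∘ φ.symm) (φ (scale c ζ))).comp (L : _ →L[ℝ] _) := by
    rw [hφL, ← L.comp_right_fderiv]
    congr 1
    funext x
    simp [hsymm]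
  have hq' : c ^ 2 • fderiv ℝ (q ∘ φ.symm) (φ ζ) =
      (fderiv ℝ (q ∘ φ.symm) (φ (scale c ζ))).comp (L : _ →L[ℝ] _) := by
    rw [hφL, ← L.comp_right_fderiv, ← Pi.smul_apply, ← fderiv_const_smul_field]
    congr 1
    funext x
    simp [hsymm, hq]
  rw [Finset.mul_sum]
  refine Finset.sum_congr rfl fun i _ => ?_
  have e1 := DFunLike.congr_fun hq' (0, EuclideanSpace.proj i)
  have e2 := DFunLike.congr_fun hq' (EuclideanSpace.single i 1, 0)
  have e3 := DFunLike.congr_fun hu (0, EuclideanSpace.proj i)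
  have e4 := DFunLike.congr_fun hu (EuclideanSpace.single i 1, 0)
  have hs : ((0 : EuclideanSpace ℝ (Fin n)), c • (EuclideanSpace.proj i :
      EuclideanSpace ℝ (Fin n) →L[ℝ] ℝ)) = c • (0, EuclideanSpace.proj i) := by
    rw [Prod.smul_mk, smul_zero]
  simp only [ContinuousLinearMap.comp_apply, ContinuousLinearEquiv.coe_coe, hL, smul_zero, hs,
    map_smul, smul_apply, smul_eq_mul] at e1 e2 e3 e4
  rw [e3, e4, ← e2]
  have e1' : fderiv ℝ (q ∘ φ.symm) (φ (scale c ζ)) (0, EuclideanSpace.proj i)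
      = c * fderiv ℝ (q ∘ φ.symm) (φ ζ) (0, EuclideanSpace.proj i) := by
    apply mul_left_cancel₀ hc
    rw [← e1]
    ring
  rw [e1']
  field_simp

lemma hamilton_div_two (q f : Cotangent n M → ℝ) (ζ : Cotangent n M) :
    hamilton (fun ζ' => q ζ' / 2) f ζ = hamilton q f ζ / 2 := by
  unfold hamilton
  have h1 : (fun ζ' => q ζ' / 2) ∘ (extChartAt (cotModel n) ζ).symm
      = (2⁻¹ : ℝ) • (q ∘ (extChartAt (cotModel n) ζ).symm) := by
    funext x
    simp [div_eq_inv_mul]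
  simp only [h1, fderiv_const_smul_field, Pi.smul_apply, smul_apply, smul_eq_mul,
    Finset.sum_div]
  exact Finset.sum_congr rfl fun i _ => by ring

lemma hamilton_const (q : Cotangent n M → ℝ) (a : ℝ) (ζ : Cotangent n M) :
    hamilton q (fun _ => a) ζ = 0 := by
  unfold hamilton
  have h1 : (fun _ => a) ∘ (extChartAt (cotModel n) ζ).symm = fun _ => a := rfl
  simp only [h1, fderiv_fun_const, Pi.zero_apply, zero_apply, mul_zero, sub_zero,
    Finset.sum_const_zero]

/-! ### Smoothness of the metric function and the projected geodesic field -/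

lemma exists_equiv_of_pos {V : Type} [NormedAddCommGroup V] [InnerProductSpace ℝ V]
    [FiniteDimensional ℝ V] (B : V →L[ℝ] V →L[ℝ] ℝ) (hB : ∀ v, v ≠ 0 → 0 < B v v) :
    ∃ e : V ≃L[ℝ] (V →L[ℝ] ℝ), (e : V →L[ℝ] V →L[ℝ] ℝ) = B := by
  have hinj : Function.Injective (B : V →ₗ[ℝ] V →L[ℝ] ℝ) := by
    rw [injective_iff_map_eq_zero]
    intro v hv
    by_contra h0
    have h1 := hB v h0
    have h2 : B v = 0 := hv
    rw [h2] at h1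
    simp at h1
  have hdim : Module.finrank ℝ V = Module.finrank ℝ (V →L[ℝ] ℝ) :=
    LinearEquiv.finrank_eq (InnerProductSpace.toDual ℝ V).toLinearEquiv
  exact ⟨(LinearEquiv.ofInjectiveOfFinrankEq (B : V →ₗ[ℝ] V →L[ℝ] ℝ) hinj
    hdim).toContinuousLinearEquiv, by ext v w; rfl⟩

/-- The dual quadratic form of a scalar product does not depend on the coordinates in which it is
computed. -/
lemma apply_inverse_congr {V : Type} [NormedAddCommGroup V] [InnerProductSpace ℝ V]
    [FiniteDimensional ℝ V] (B A : V →L[ℝ] V →L[ℝ] ℝ) (hB : ∀ v, v ≠ 0 → 0 < B v v)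
    (T : V →L[ℝ] V) (T' : V →L[ℝ] V) (hTT : ∀ v, T (T' v) = v) (hTT' : ∀ v, T' (T v) = v)
    (hA : ∀ v w, A v w = B (T v) (T w)) (l : V →L[ℝ] ℝ) :
    l (B.inverse l) = (l ∘L T) (A.inverse (l ∘L T)) := by
  have hApos : ∀ v, v ≠ 0 → 0 < A v v := by
    intro v hv
    rw [hA]
    refine hB _ fun h0 => hv ?_
    rw [← hTT' v, h0, map_zero]
  have h1 := apply_inverse_of_pos A hApos (l ∘L T)
  have h2 := apply_inverse_of_pos B hB l
  set a := A.inverse (l ∘L T)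
  set x := B.inverse l
  have h3 : B (T a) = B x := by
    ext w
    rw [h2, ← hTT w, ← hA, h1]
    rfl
  have h4 : T a - x = 0 := by
    by_contra h0
    have := hB _ h0
    have h5 : B (T a - x) = 0 := by rw [map_sub, h3, sub_self]
    rw [h5] at this
    simp at this
  rw [ContinuousLinearMap.comp_apply, sub_eq_zero.1 h4]

/-- In coordinates the metric function is `μ (A⁻¹ μ)`, where `A` is the smooth matrix of the metric
and `μ` the fibre coordinate; inversion is smooth near an invertible map. -/
lemma contMDiff_metricFn (h : Metric n M) :
    ContMDiff (cotModel n) 𝓘(ℝ, ℝ) ∞ (metricFn h) := by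
  intro ζ
  let p := ζ.proj
  let e := trivializationAt (EuclideanSpace ℝ (Fin n)) (TangentSpace (𝓡 n) (M := M)) p
  have hmet := h.contMDiff p
  rw [contMDiffAt_hom_bundle] at hmet
  -- The matrix of the metric in the frame induced by the chart at `p`.
  let A : M → EuclideanSpace ℝ (Fin n) →L[ℝ] EuclideanSpace ℝ (Fin n) →L[ℝ] ℝ := fun b =>
    ContinuousLinearMap.inCoordinates (EuclideanSpace ℝ (Fin n)) (TangentSpace (𝓡 n) (M := M))
      (EuclideanSpace ℝ (Fin n) →L[ℝ] ℝ)
      (fun p : M => TangentSpace (𝓡 n) p →L[ℝ] Bundle.Trivial M ℝ p) p b p b (h.inner b)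
  have hAsm : ContMDiffAt (𝓡 n)
      𝓘(ℝ, EuclideanSpace ℝ (Fin n) →L[ℝ] EuclideanSpace ℝ (Fin n) →L[ℝ] ℝ) ∞ A p := hmet.2
  have hAv : ∀ b ∈ e.baseSet, ∀ v w, A b v w = h.inner b (e.symmL ℝ b v) (e.symmL ℝ b w) := by
    intro b hb v w
    have := inCoordinates_apply_eq₂ (F₁ := EuclideanSpace ℝ (Fin n))
      (E₁ := TangentSpace (𝓡 n) (M := M))
      (F₂ := EuclideanSpace ℝ (Fin n)) (E₂ := TangentSpace (𝓡 n) (M := M))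
      (F₃ := ℝ) (E₃ := Bundle.Trivial M ℝ) (x₀ := p) (x := b) (ϕ := h.inner b) (v := v) (w := w)
      hb hb (by simp)
    refine this.trans ?_
    change ((Bundle.Trivial.trivialization M ℝ).linearMapAt ℝ b) _ = _
    rw [Bundle.Trivial.linearMapAt_trivialization, LinearMap.id_apply, e.symmL_apply hb,
      e.symmL_apply hb]
  let μ : Cotangent n M → EuclideanSpace ℝ (Fin n) →L[ℝ] ℝ := fun ζ' =>
    (trivializationAt (EuclideanSpace ℝ (Fin n) →L[ℝ] ℝ)
      (fun p : M => TangentSpace (𝓡 n) p →L[ℝ] Bundle.Trivial M ℝ p) p ζ').2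
  have hμ : ContMDiffAt (cotModel n) 𝓘(ℝ, EuclideanSpace ℝ (Fin n) →L[ℝ] ℝ) ∞ μ ζ :=
    (contMDiffAt_totalSpace.1 (contMDiffAt_id (I := cotModel n) (n := ∞) (x := ζ))).2
  have hμe : ∀ ζ', μ ζ' = ζ'.snd ∘L e.symmL ℝ ζ'.proj := fun ζ' => by
    simp only [μ, trivializationAt_cotangent_apply]
    rfl
  have hproj : ContMDiffAt (cotModel n) (𝓡 n) ∞
      (TotalSpace.proj : Cotangent n M → M) ζ := contMDiffAt_proj _
  have hbase : e.baseSet ∈ 𝓝 p := e.open_baseSet.mem_nhds (mem_baseSet_trivializationAt _ _ p)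
  have hbp : p ∈ e.baseSet := mem_baseSet_trivializationAt _ _ p
  have hpos : ∀ b ∈ e.baseSet, ∀ v, v ≠ 0 → 0 < A b v v := by
    intro b hb v hv
    rw [hAv b hb]
    refine h.pos _ _ fun h0 => hv ?_
    rw [← e.continuousLinearMapAt_symmL (R := ℝ) hb v, h0, map_zero]
  have hinv : ContMDiffAt (cotModel n)
      𝓘(ℝ, (EuclideanSpace ℝ (Fin n) →L[ℝ] ℝ) →L[ℝ] EuclideanSpace ℝ (Fin n)) ∞
      (fun ζ' : Cotangent n M => (A ζ'.proj).inverse) ζ := by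
    obtain ⟨E, hE⟩ := exists_equiv_of_pos (A p) (hpos p hbp)
    have h1 : ContDiffAt ℝ ∞ ContinuousLinearMap.inverse (A p) := by
      rw [← hE]
      exact contDiffAt_map_inverse E
    exact (h1.contMDiffAt).comp ζ (hAsm.comp ζ hproj)
  refine (hμ.clm_apply (hinv.clm_apply hμ)).congr_of_eventuallyEq ?_
  filter_upwards [hproj.continuousAt hbase] with ζ' hb
  rw [hμe]
  exact apply_inverse_congr (V := EuclideanSpace ℝ (Fin n)) (h.inner ζ'.proj) (A ζ'.proj)
    (h.pos ζ'.proj)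
    (e.symmL ℝ ζ'.proj) (e.continuousLinearMapAt ℝ ζ'.proj)
    (fun v => e.symmL_continuousLinearMapAt hb v) (fun v => e.continuousLinearMapAt_symmL hb v)
    (hAv _ hb) ζ'.snd

/-- The bilinear form dual to the metric is symmetric. -/
lemma sharp_symm (h : Metric n M) (p : M) (l ν : TangentSpace (𝓡 n) p →L[ℝ] ℝ) :
    l ((h.inner p).inverse ν) = ν ((h.inner p).inverse l) := by
  have h1 : h.inner p ((h.inner p).inverse l) = l := inner_sharp h ⟨p, l⟩
  have h2 : h.inner p ((h.inner p).inverse ν) = ν := inner_sharp h ⟨p, ν⟩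
  calc l ((h.inner p).inverse ν)
      = h.inner p ((h.inner p).inverse l) ((h.inner p).inverse ν) := by rw [h1]
    _ = h.inner p ((h.inner p).inverse ν) ((h.inner p).inverse l) := h.symm p _ _
    _ = ν ((h.inner p).inverse l) := by rw [h2]

lemma hasDerivAt_metricFn_add_smul (h : Metric n M) (p : M)
    (l ν : TangentSpace (𝓡 n) p →L[ℝ] ℝ) :
    HasDerivAt (fun t : ℝ => metricFn h (⟨p, l + t • ν⟩ : Cotangent n M))
      (2 * ν ((h.inner p).inverse l)) 0 := by
  have h1 : (fun t : ℝ => metricFn h (⟨p, l + t • ν⟩ : Cotangent n M)) = fun t =>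
      l ((h.inner p).inverse l) + t * (2 * ν ((h.inner p).inverse l))
        + t ^ 2 * ν ((h.inner p).inverse ν) := by
    funext t
    change (l + t • ν) ((h.inner p).inverse (l + t • ν)) = _
    have e1 : (h.inner p).inverse (l + t • ν)
        = (h.inner p).inverse l + t • (h.inner p).inverse ν := by rw [map_add, map_smul]
    rw [e1, map_add, map_smul]
    change l ((h.inner p).inverse l) + t * ν ((h.inner p).inverse l)
      + t * (l ((h.inner p).inverse ν) + t * ν ((h.inner p).inverse ν)) = _
    rw [sharp_symm h p l ν]
    ring
  rw [h1]
  have h2 := (((hasDerivAt_id (0 : ℝ)).mul_const (2 * ν ((h.inner p).inverse l))).const_add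
    (l ((h.inner p).inverse l))).add
    (((hasDerivAt_id (0 : ℝ)).pow 2).mul_const (ν ((h.inner p).inverse ν)))
  refine h2.congr_deriv ?_
  simp

lemma symmL_trivializationAt_self (p : M) :
    (trivializationAt (EuclideanSpace ℝ (Fin n)) (TangentSpace (𝓡 n)) p).symmL ℝ p =
      ContinuousLinearMap.id ℝ (EuclideanSpace ℝ (Fin n)) := by
  rw [TangentBundle.symmL_trivializationAt_eq_core (mem_chart_source _ p)]
  ext1 v
  exact (tangentBundleCore (𝓡 n) M).coordChange_self (achart _ p) p (mem_chart_source _ p) v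

/-- The vertical derivatives of the metric function in canonical coordinates. -/
lemma fderiv_metricFn_vertical (h : Metric n M) (ζ : Cotangent n M)
    (ν : EuclideanSpace ℝ (Fin n) →L[ℝ] ℝ) :
    fderiv ℝ (metricFn h ∘ (extChartAt (cotModel n) ζ).symm) (extChartAt (cotModel n) ζ ζ)
      (0, ν) = 2 * ν (sharp h ζ) := by
  set φ := extChartAt (cotModel n) ζ with hφ
  have hd : DifferentiableAt ℝ (metricFn h ∘ φ.symm) (φ ζ) := by
    have h1 := (contMDiff_metricFn h).mdifferentiable (by simp) ζ
    have h2 := h1.differentiableWithinAt_writtenInExtChartAt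
    have h3 : Set.range (cotModel n) = Set.univ := by
      simp
    rw [h3, differentiableWithinAt_univ] at h2
    exact h2
  have hline : HasDerivAt (fun t : ℝ => φ ζ + t • ((0 : EuclideanSpace ℝ (Fin n)), ν))
      (0, ν) 0 := by
    simpa using ((hasDerivAt_id (0 : ℝ)).smul_const ((0 : EuclideanSpace ℝ (Fin n)), ν)).const_add
      (φ ζ)
  have hd' : HasFDerivAt (metricFn h ∘ φ.symm) (fderiv ℝ (metricFn h ∘ φ.symm) (φ ζ))
      (φ ζ + (0 : ℝ) • ((0 : EuclideanSpace ℝ (Fin n)), ν)) := by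
    simpa using hd.hasFDerivAt
  have h1 := hd'.comp_hasDerivAt 0 hline
  let ν' : TangentSpace (𝓡 n) ζ.proj →L[ℝ] Bundle.Trivial M ℝ ζ.proj := ν
  have h2 : ∀ t : ℝ, φ.symm (φ ζ + t • ((0 : EuclideanSpace ℝ (Fin n)), ν)) =
      (⟨ζ.proj, ζ.snd + t • ν'⟩ : Cotangent n M) := by
    intro t
    have h3 : φ (⟨ζ.proj, ζ.snd + t • ν'⟩ : Cotangent n M) =
        φ ζ + t • ((0 : EuclideanSpace ℝ (Fin n)), ν) := by
      rw [hφ, extChartAt_eq, extChartAt_eq, symmL_trivializationAt_self]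
      ext1
      · simp
      · rfl
    rw [← h3]
    refine φ.left_inv ?_
    rw [hφ, FiberBundle.extChartAt]
    simp
  have h4 := hasDerivAt_metricFn_add_smul h ζ.proj ζ.snd ν
  refine h1.unique (h4.congr_of_eventuallyEq (Eventually.of_forall fun t => ?_))
  simp only [Function.comp_apply, h2]
  rfl

/-- The geodesic Hamilton field projects to the vector `♯ζ` dual to the covector `ζ`. -/
lemma hamilton_comp_proj (h : Metric n M) (ζ : Cotangent n M) {f : M → ℝ}
    (hf : ContMDiff (𝓡 n) 𝓘(ℝ, ℝ) ∞ f) :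
    hamilton (fun ζ' => metricFn h ζ' / 2) (fun ζ' => f ζ'.proj) ζ =
      mfderiv (𝓡 n) 𝓘(ℝ, ℝ) f ζ.proj (sharp h ζ) := by
  rw [hamilton_div_two]
  unfold hamilton
  dsimp only
  have hfm := hf.mdifferentiable (by simp) ζ.proj
  have hfd := hfm.differentiableWithinAt_writtenInExtChartAt
  have hr : Set.range (𝓡 n) = Set.univ := ModelWithCorners.range_eq_univ _
  rw [hr, differentiableWithinAt_univ] at hfd
  have hfd' : DifferentiableAt ℝ (f ∘ (extChartAt (𝓡 n) ζ.proj).symm)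
    (extChartAt (𝓡 n) ζ.proj ζ.proj) := hfd
  have hmf : mfderiv (𝓡 n) 𝓘(ℝ, ℝ) f ζ.proj =
      fderiv ℝ (f ∘ (extChartAt (𝓡 n) ζ.proj).symm) (extChartAt (𝓡 n) ζ.proj ζ.proj) :=
    HasMFDerivAt.mfderiv ⟨hfm.continuousAt, hfd'.hasFDerivAt.hasFDerivWithinAt⟩
  have hcomp : (fun ζ' : Cotangent n M => f ζ'.proj) ∘ (extChartAt (cotModel n) ζ).symm =
      (f ∘ (extChartAt (𝓡 n) ζ.proj).symm) ∘ Prod.fst := by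
    funext ⟨y, ν⟩
    simp only [Function.comp_apply, extChartAt_symm_eq]
  have hfst : (extChartAt (cotModel n) ζ ζ).1 = extChartAt (𝓡 n) ζ.proj ζ.proj := by
    rw [extChartAt_eq]
  have hF : fderiv ℝ ((fun ζ' : Cotangent n M => f ζ'.proj) ∘ (extChartAt (cotModel n) ζ).symm)
      (extChartAt (cotModel n) ζ ζ) =
      (fderiv ℝ (f ∘ (extChartAt (𝓡 n) ζ.proj).symm) (extChartAt (𝓡 n) ζ.proj ζ.proj)).comp
        (ContinuousLinearMap.fst ℝ _ _) := by
    rw [hcomp]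
    rw [← hfst] at hfd' ⊢
    exact (hfd'.hasFDerivAt.comp _ hasFDerivAt_fst).fderiv
  rw [hF, hmf]
  simp only [fderiv_metricFn_vertical, ContinuousLinearMap.comp_apply,
    ContinuousLinearMap.coe_fst', map_zero, mul_zero, sub_zero]
  have hv : ∀ (L : EuclideanSpace ℝ (Fin n) →L[ℝ] ℝ) (v : EuclideanSpace ℝ (Fin n)),
      (∑ i, 2 * EuclideanSpace.proj i v * L (EuclideanSpace.single i 1)) / 2 = L v := by
    intro L v
    conv_rhs => rw [← (EuclideanSpace.basisFun (Fin n) ℝ).sum_repr v, map_sum]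
    rw [Finset.sum_div]
    refine Finset.sum_congr rfl fun i _ => ?_
    simp
    ring
  exact hv _ _

/-- A continuous curve along which every smooth function has the derivative prescribed by a fixed
tangent vector is differentiable, with that velocity. -/
lemma hasMFDerivAt_of_forall_smooth [T2Space M] {c : ℝ → M} {s : ℝ} (hc : ContinuousAt c s)
    (v : TangentSpace (𝓡 n) (c s))
    (hv : ∀ f : M → ℝ, ContMDiff (𝓡 n) 𝓘(ℝ, ℝ) ∞ f →
      HasDerivAt (fun t => f (c t)) (mfderiv (𝓡 n) 𝓘(ℝ, ℝ) f (c s) v) s) :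
    HasMFDerivAt 𝓘(ℝ, ℝ) (𝓡 n) c s (ContinuousLinearMap.toSpanSingleton ℝ v) := by
  let ρ : SmoothBumpFunction (𝓡 n) (c s) := Classical.arbitrary _
  let ψ := extChartAt (𝓡 n) (c s)
  let w : EuclideanSpace ℝ (Fin n) := v
  -- The coordinates of a chart extend, near the point, to smooth functions on all of `M`.
  have hcoord : ∀ i, HasDerivAt (fun t => ψ (c t) i) (w i) s := by
    intro i
    have hsm : ContMDiff (𝓡 n) 𝓘(ℝ, ℝ) ∞ (fun q => ρ q • (ψ q) i) := by
      refine ρ.contMDiff_smul ?_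
      exact (EuclideanSpace.proj (𝕜 := ℝ) i).contMDiff.comp_contMDiffOn contMDiffOn_extChartAt
    have heq : (fun q => ρ q • (ψ q) i) =ᶠ[𝓝 (c s)] fun q => (ψ q) i := by
      filter_upwards [ρ.eventuallyEq_one] with q hq
      rw [hq]; simp
    have h1 := hv _ hsm
    have h2 : mfderiv (𝓡 n) 𝓘(ℝ, ℝ) (fun q => ρ q • (ψ q) i) (c s) v = w i := by
      rw [heq.mfderiv_eq]
      have h3 : HasMFDerivAt (𝓡 n) 𝓘(ℝ, ℝ) (fun q => (ψ q) i) (c s)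
          (EuclideanSpace.proj (𝕜 := ℝ) i : EuclideanSpace ℝ (Fin n) →L[ℝ] ℝ) := by
        refine ⟨(EuclideanSpace.proj (𝕜 := ℝ) i).continuous.continuousAt.comp
          (continuousAt_extChartAt _), ?_⟩
        refine ((EuclideanSpace.proj (𝕜 := ℝ) i).hasFDerivWithinAt).congr_of_eventuallyEq ?_ ?_
        · filter_upwards [extChartAt_target_mem_nhdsWithin (I := 𝓡 n) (c s)] with y hy
          simp [writtenInExtChartAt, ψ, -extChartAt, extChartAt_model_space_eq_id,
            (extChartAt (𝓡 n) (c s)).right_inv hy]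
        · simp [writtenInExtChartAt, ψ, -extChartAt, extChartAt_model_space_eq_id,
            (extChartAt (𝓡 n) (c s)).left_inv (mem_extChartAt_source (c s))]
      rw [h3.mfderiv]
      rfl
    rw [h2] at h1
    refine h1.congr_of_eventuallyEq ?_
    filter_upwards [hc.eventually heq] with t ht
    exact ht.symm
  refine ⟨hc, ?_⟩
  have h4 : HasFDerivWithinAt (fun t => ψ (c t)) (ContinuousLinearMap.toSpanSingleton ℝ w)
      (Set.range 𝓘(ℝ, ℝ)) s := by
    rw [hasFDerivWithinAt_euclidean]
    intro i
    refine (hcoord i).hasFDerivAt.hasFDerivWithinAt.congr_fderiv ?_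
    ext
    simp
  exact h4

/-! ### Calculus on intervals -/

lemma countable_of_forall_isolated {s : Set ℝ}
    (hs : ∀ x ∈ s, ∃ ε > 0, ∀ y ∈ s, 0 < |y - x| → |y - x| < ε → False) : s.Countable := by
  refine (countable_setOfPred_isolated_right_within (s := s)).mono fun x hx => ?_
  obtain ⟨ε, hε, h⟩ := hs x hx
  refine ⟨hx, ?_⟩
  rw [← Filter.empty_mem_iff_bot, mem_nhdsWithin]
  refine ⟨Set.Iio (x + ε), isOpen_Iio, by simpa using hε, ?_⟩
  rintro y ⟨h2, hy, h1⟩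
  have h1' : x < y := h1
  have h2' : y < x + ε := h2
  have h3 : |y - x| = y - x := abs_of_pos (by linarith)
  exact (h y hy (by rw [h3]; linarith) (by rw [h3]; linarith)).elim

/-- A continuous function whose derivative agrees off a countable set with a continuous function is
differentiable everywhere. -/
lemma hasDerivWithinAt_of_off_countable {I N : Set ℝ} (hI : I.OrdConnected) {f g : ℝ → ℝ}
    (hf : ContinuousOn f I) (hg : ContinuousOn g I) (hN : N.Countable)
    (hd : ∀ t ∈ I \ N, HasDerivWithinAt f (g t) I t) {t : ℝ} (ht : t ∈ I) :
    HasDerivWithinAt f (g t) I t := by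
  rw [hasDerivWithinAt_iff_isLittleO, Asymptotics.isLittleO_iff]
  intro c hc
  obtain ⟨δ, hδ, hgδ⟩ := Metric.continuousWithinAt_iff.1 (hg t ht) c hc
  filter_upwards [self_mem_nhdsWithin, mem_nhdsWithin_of_mem_nhds (Metric.ball_mem_nhds t hδ)]
    with x hx hxδ
  have hsub : Set.uIcc t x ⊆ I := hI.uIcc_subset ht hx
  have hint : IntervalIntegrable g MeasureTheory.volume t x :=
    (hg.mono hsub).intervalIntegrable
  have hftc : ∫ y in t..x, g y = f x - f t := by
    refine MeasureTheory.integral_eq_of_hasDerivAt_off_countable f g hN (hf.mono hsub) ?_ hint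
    intro y hy
    have hyI : Set.Ioo (min t x) (max t x) ⊆ I := Set.Ioo_subset_Icc_self.trans hsub
    exact (hd y ⟨hyI hy.1, hy.2⟩).hasDerivAt
      (mem_of_superset (isOpen_Ioo.mem_nhds hy.1) hyI)
  have h1 : f x - f t - (x - t) • g t = ∫ y in t..x, (g y - g t) := by
    rw [intervalIntegral.integral_sub hint intervalIntegrable_const, hftc,
      intervalIntegral.integral_const]
  rw [h1]
  refine intervalIntegral.norm_integral_le_of_norm_le_const fun y hy => ?_
  have hy' := Set.uIoc_subset_uIcc hy
  refine (hgδ (hsub hy') ?_).le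
  rw [Metric.mem_ball, Real.dist_eq] at hxδ
  rw [Real.dist_eq]
  exact (Set.abs_sub_left_of_mem_uIcc hy').trans_lt hxδ

lemma eq_of_hasDerivWithinAt_zero {I : Set ℝ} (hI : I.OrdConnected) {f : ℝ → ℝ}
    (hf : ∀ t ∈ I, HasDerivWithinAt f 0 I t) {a b : ℝ} (ha : a ∈ I) (hb : b ∈ I) : f a = f b := by
  have h := hI.convex.norm_image_sub_le_of_norm_hasDerivWithin_le (C := 0) hf (by simp) hb ha
  rw [zero_mul] at h
  exact sub_eq_zero.1 (norm_le_zero_iff.1 h)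

/-- The angle `θ` with `τ = √lam cos θ` satisfies the differential equation defining the
reparametrization when `τ` satisfies the Hamilton equation. -/
lemma hasDerivWithinAt_arccos_tau {I : Set ℝ} {τ : ℝ → ℝ} {lam t : ℝ} (hlt : τ t ^ 2 < lam)
    (hτ : HasDerivWithinAt τ (-2 * (lam - τ t ^ 2)) I t) :
    HasDerivWithinAt (fun t => Real.arccos (τ t / √lam)) (2 * √(lam - τ t ^ 2)) I t := by
  have hlam : 0 < lam := (sq_nonneg _).trans_lt hlt
  have hr : 0 < √lam := Real.sqrt_pos.2 hlam
  have hlt' : (τ t / √lam) ^ 2 < 1 := by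
    rw [div_pow, Real.sq_sqrt hlam.le, div_lt_one hlam]
    exact hlt
  have hab := abs_lt.1 ((sq_lt_one_iff_abs_lt_one _).1 hlt')
  have h1 := (Real.hasDerivAt_arccos hab.1.ne' hab.2.ne).comp_hasDerivWithinAt t
    (hτ.div_const (√lam))
  refine h1.congr_deriv ?_
  have h2 : 1 - (τ t / √lam) ^ 2 = (lam - τ t ^ 2) / lam := by
    rw [div_pow, Real.sq_sqrt hlam.le]
    field_simp
  have h3 : 0 < lam - τ t ^ 2 := by linarith
  have h4 : 0 < √(lam - τ t ^ 2) := Real.sqrt_pos.2 h3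
  rw [h2, Real.sqrt_div h3.le]
  field_simp
  rw [Real.sq_sqrt h3.le]

lemma sqrt_mul_cos_arccos {lam σ : ℝ} (hlt : σ ^ 2 < lam) :
    √lam * Real.cos (Real.arccos (σ / √lam)) = σ ∧
    √lam * Real.sin (Real.arccos (σ / √lam)) = √(lam - σ ^ 2) ∧
    Real.arccos (σ / √lam) ∈ Set.Ioo 0 Real.pi := by
  have hlam : 0 < lam := (sq_nonneg _).trans_lt hlt
  have hr : 0 < √lam := Real.sqrt_pos.2 hlam
  have hlt' : (σ / √lam) ^ 2 < 1 := by
    rw [div_pow, Real.sq_sqrt hlam.le, div_lt_one hlam]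
    exact hlt
  have hab := abs_lt.1 ((sq_lt_one_iff_abs_lt_one _).1 hlt')
  refine ⟨?_, ?_, ?_, ?_⟩
  · rw [Real.cos_arccos hab.1.le hab.2.le]
    field_simp
  · rw [Real.sin_arccos, ← Real.sqrt_mul hlam.le]
    congr 1
    rw [div_pow, Real.sq_sqrt hlam.le]
    field_simp
  · exact Real.arccos_pos.2 hab.2
  · refine lt_of_le_of_ne (Real.arccos_le_pi _) fun h => ?_
    rw [Real.arccos_eq_pi] at h
    linarith [hab.1]

/-- A solution of `τ' = -2 (r² - τ²)` with `|τ| < r` on the whole line takes all values in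
`(-r, r)`: the function `log ((r - τ) / (r + τ))` is affine of slope `4 r`. -/
lemma exists_tau_eq {τ : ℝ → ℝ} {r : ℝ} (hτ : ∀ t, HasDerivAt τ (-2 * (r ^ 2 - τ t ^ 2)) t)
    (hab : ∀ t, τ t ∈ Set.Ioo (-r) r) {y : ℝ} (hy : y ∈ Set.Ioo (-r) r) : ∃ t, τ t = y := by
  have hr : 0 < r := by linarith [hy.1, hy.2]
  let v : ℝ → ℝ := fun x => Real.log (r - x) - Real.log (r + x)
  have hd : ∀ t ∈ Set.univ, HasDerivWithinAt (fun t => v (τ t) - 4 * r * t) 0 Set.univ t := by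
    intro t _
    have h1 : r - τ t ≠ 0 := by linarith [(hab t).2]
    have h2 : r + τ t ≠ 0 := by linarith [(hab t).1]
    have h3 := ((((hτ t).const_sub r).log h1).sub (((hτ t).const_add r).log h2)).sub
      ((hasDerivAt_id t).const_mul (4 * r))
    refine (h3.congr_deriv ?_).hasDerivWithinAt
    field_simp
    ring
  refine ⟨(v y - v (τ 0)) / (4 * r), ?_⟩
  set t := (v y - v (τ 0)) / (4 * r) with ht
  have h1 := eq_of_hasDerivWithinAt_zero Set.ordConnected_univ hd (Set.mem_univ t)
    (Set.mem_univ 0)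
  have h2 : v (τ t) = v y := by
    have : 4 * r * t = v y - v (τ 0) := by rw [ht]; field_simp
    linarith
  have p1 : 0 < r - y := by linarith [hy.2]
  have p2 : 0 < r + y := by linarith [hy.1]
  have p3 : 0 < r - τ t := by linarith [(hab t).2]
  have p4 : 0 < r + τ t := by linarith [(hab t).1]
  have h3 : (r - τ t) * (r + y) = (r - y) * (r + τ t) := by
    refine Real.log_injOn_pos (mul_pos p3 p2) (mul_pos p1 p4) ?_
    rw [Real.log_mul p3.ne' p2.ne', Real.log_mul p1.ne' p4.ne']
    simp only [v] at h2
    linarith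
  have h4 : 2 * r * (τ t - y) = 0 := by linarith
  rcases mul_eq_zero.1 h4 with h | h
  · linarith
  · linarith

section Reparametrization
variable {I : Set ℝ} {S : ℝ → ℝ}

lemma ordConnected_image (hI : I.OrdConnected) (hc : ContinuousOn S I) : (S '' I).OrdConnected :=
  (hI.isPreconnected.image S hc).ordConnected

lemma continuousOn_invFunOn (hI : I.OrdConnected) (hm : StrictMonoOn S I)
    (hc : ContinuousOn S I) : ContinuousOn (Function.invFunOn S I) (S '' I) := by
  have := hI
  have := ordConnected_image hI hc
  have h1 : Continuous fun y : S '' I => ((hm.orderIso S I).symm y : ℝ) :=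
    continuous_subtype_val.comp (hm.orderIso S I).symm.continuous
  rw [continuousOn_iff_continuous_domRestrict]
  convert h1 using 1
  funext y
  have h2 : S (Function.invFunOn S I y) = y := Function.invFunOn_eq y.2
  have h3 : S ((hm.orderIso S I).symm y) = y :=
    congrArg Subtype.val ((hm.orderIso S I).apply_symm_apply y)
  exact hm.injOn (Function.invFunOn_mem y.2) (Subtype.coe_prop _) (h2.trans h3.symm)

lemma hasDerivWithinAt_invFunOn (hI : I.OrdConnected) (hm : StrictMonoOn S I)
    (hc : ContinuousOn S I) {t a : ℝ} (ht : t ∈ I) (ha : a ≠ 0)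
    (hd : HasDerivWithinAt S a I t) :
    HasDerivWithinAt (Function.invFunOn S I) a⁻¹ (S '' I) (S t) := by
  have hT : Function.invFunOn S I (S t) = t :=
    hm.injOn (Function.invFunOn_mem ⟨t, ht, rfl⟩) ht (Function.invFunOn_eq ⟨t, ht, rfl⟩)
  have hmaps : Set.MapsTo (Function.invFunOn S I) (S '' I) I :=
    fun y hy => Function.invFunOn_mem hy
  have hcont := continuousOn_invFunOn hI hm hc (S t) ⟨t, ht, rfl⟩
  have htend : Tendsto (Function.invFunOn S I) (𝓝[S '' I] (S t))
      (𝓝[I] (Function.invFunOn S I (S t))) := hcont.tendsto_nhdsWithin hmaps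
  have hd' : HasFDerivWithinAt S
      ((ContinuousLinearEquiv.unitsEquivAut ℝ (Units.mk0 a ha) : ℝ ≃L[ℝ] ℝ) : ℝ →L[ℝ] ℝ) I
      (Function.invFunOn S I (S t)) := by
    rw [hT]
    refine hd.hasFDerivWithinAt.congr_fderiv ?_
    ext
    simp
  have h1 := HasFDerivWithinAt.of_local_left_inverse htend hd' ⟨t, ht, rfl⟩
    (by filter_upwards [self_mem_nhdsWithin] with y hy using Function.invFunOn_eq hy)
  refine h1.hasDerivWithinAt.congr_deriv ?_
  simp

end Reparametrization

/-! ### Continuity and rescaling on the compressed bundles -/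

omit [IsManifold (𝓡 n) ∞ M] in
lemma DotCotangent.one_smul' (ζ : DotCotangent n 𝒞) : (1 : ℝ) • ζ = ζ :=
  congrArg (DotCotangent.mk ζ.base) (one_smul ℝ ζ.covec)

omit [IsManifold (𝓡 n) ∞ M] in
lemma DotCotangent.smul_smul' (r s : ℝ) (ζ : DotCotangent n 𝒞) : r • s • ζ = (r * s) • ζ :=
  congrArg (DotCotangent.mk ζ.base) (smul_smul r s ζ.covec)

lemma piBdry_scale (r : ℝ) (ζ : Cotangent n M) : piBdry 𝒞 (scale r ζ) = r • piBdry 𝒞 ζ := rfl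

lemma continuous_tau : Continuous (ScDot.tau : ScDot n 𝒞 → ℝ) :=
  continuous_coinduced_dom.2 continuous_fst

lemma DotCotangent.continuous_base : Continuous (DotCotangent.base : DotCotangent n 𝒞 → M) :=
  continuous_coinduced_dom.2 (FiberBundle.continuous_proj _ _)

/-- The fibre variable rescaled by the value at `τ` of a function of one variable. -/
def rescale (f : ℝ → ℝ) (ξ : ScDot n 𝒞) : DotCotangent n 𝒞 := f ξ.tau • ξ.fib

/-- Continuity is tested on `ℝ × T*M`, from which the topology of the compressed bundle is
coinduced, where the rescaling lifts. -/
lemma continuous_rescale {f : ℝ → ℝ} (hf : Continuous f) :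
    Continuous (rescale f : ScDot n 𝒞 → DotCotangent n 𝒞) := by
  refine continuous_coinduced_dom.2 ?_
  have h1 : Continuous (fun ξ : ScCotangent n M => scale (f ξ.1) ξ.2) :=
    (contMDiff_scale (n := n) (M := M)).continuous.comp
      ((hf.comp continuous_fst).prodMk continuous_snd)
  exact (continuous_coinduced_rng (f := (piBdry 𝒞 : Cotangent n M → _))).comp h1

lemma contMDiff_scale_comp {f : ℝ → ℝ} (hf : ContDiff ℝ ∞ f) :
    ContMDiff (𝓘(ℝ, ℝ).prod (cotModel n)) (cotModel n) ∞
      (fun ξ : ScCotangent n M => scale (f ξ.1) ξ.2) :=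
  contMDiff_scale.comp ((hf.contMDiff.comp contMDiff_fst).prodMk contMDiff_snd)

/-! ### The normalizing factor -/

/-- The factor by which a covector over `τ` in the characteristic set is normalized to length
one; it is `0` when `σ² ≥ lam`. -/
def normFactor (lam σ : ℝ) : ℝ := (√(lam - σ ^ 2))⁻¹

lemma normFactor_pos {lam σ : ℝ} (hσ : σ ^ 2 < lam) : 0 < normFactor lam σ :=
  inv_pos.2 (Real.sqrt_pos.2 (by linarith))

lemma sq_mul_normFactor {lam σ : ℝ} (hσ : σ ^ 2 < lam) :
    normFactor lam σ ^ 2 * (lam - σ ^ 2) = 1 := by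
  have h1 : 0 < lam - σ ^ 2 := by linarith
  rw [normFactor, inv_pow, Real.sq_sqrt h1.le, inv_mul_cancel₀ h1.ne']

lemma hasDerivAt_normFactor {lam σ : ℝ} (hσ : σ ^ 2 < lam) :
    HasDerivAt (normFactor lam) (σ * normFactor lam σ ^ 3) σ := by
  have h1 : 0 < lam - σ ^ 2 := by linarith
  have h2 : 0 < √(lam - σ ^ 2) := Real.sqrt_pos.2 h1
  have h3 := (((hasDerivAt_pow 2 σ).const_sub lam).sqrt h1.ne').inv h2.ne'
  refine h3.congr_deriv ?_
  simp only [normFactor]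
  field_simp
  norm_num

lemma contDiffAt_normFactor {lam σ : ℝ} (hσ : σ ^ 2 < lam) :
    ContDiffAt ℝ ∞ (normFactor lam) σ := by
  have h1 : 0 < lam - σ ^ 2 := by linarith
  have h2 : 0 < √(lam - σ ^ 2) := Real.sqrt_pos.2 h1
  refine ContDiffAt.inv (ContDiffAt.sqrt ?_ h1.ne') h2.ne'
  fun_prop

/-- The normalizing factor agrees near each admissible `τ` with a function smooth on all of `ℝ`, as
is needed for test functions, which are defined on the whole bundle. -/
lemma exists_contDiff_eq_normFactor {lam σ : ℝ} (hσ : σ ^ 2 < lam) :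
    ∃ f : ℝ → ℝ, ContDiff ℝ ∞ f ∧ f =ᶠ[𝓝 σ] normFactor lam := by
  have hopen : IsOpen {x : ℝ | x ^ 2 < lam} := isOpen_lt (by fun_prop) continuous_const
  obtain ⟨δ, hδ, hsub⟩ := Metric.isOpen_iff.1 hopen σ hσ
  let χ : ContDiffBump σ := ⟨δ / 4, δ / 2, by linarith, by linarith⟩
  refine ⟨fun x => χ x * normFactor lam x, ?_, ?_⟩
  · rw [contDiff_iff_contDiffAt]
    intro x
    by_cases hx : x ∈ Metric.ball σ δ
    · exact χ.contDiff.contDiffAt.mul (contDiffAt_normFactor (hsub hx))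
    · have hx' : x ∉ tsupport χ := by
        rw [χ.tsupport_eq]
        intro h
        exact hx (Metric.closedBall_subset_ball (by simp only [χ]; linarith) h)
      have h0 : (fun x => χ x * normFactor lam x) =ᶠ[𝓝 x] fun _ => 0 := by
        filter_upwards [(isClosed_tsupport χ).isOpen_compl.mem_nhds hx'] with y hy
        rw [image_eq_zero_of_notMem_tsupport hy, zero_mul]
      exact contDiffAt_const.congr_of_eventuallyEq h0
  · filter_upwards [χ.eventuallyEq_one] with x hx
    rw [hx]; simp

/-! ### The characteristic set and the cosphere bundle -/

lemma metricFn_of_mem_charSet {h : Metric n M} {lam : ℝ} {ξ : ScCotangent n M}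
    (hξ : ξ ∈ charSet h lam) : metricFn h ξ.2 = lam - ξ.1 ^ 2 := by
  have h1 : ξ.1 ^ 2 + metricFn h ξ.2 - lam = 0 := hξ
  linarith

lemma tau_sq_lt {h : Metric n M} {lam : ℝ} {ξ : ScDot n 𝒞} (hξ : ξ ∈ dotChar 𝒞 h lam)
    (hrad : ξ ∉ radialPlus 𝒞 h lam ∪ radialMinus 𝒞 h lam) : ξ.tau ^ 2 < lam := by
  obtain ⟨η, hη, rfl⟩ := hξ
  have h1 := metricFn_of_mem_charSet hη
  have h2 := metricFn_nonneg h η.2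
  change η.1 ^ 2 < lam
  by_contra hlt
  have h3 : metricFn h η.2 = 0 := by linarith
  have h4 : lam = η.1 ^ 2 := by linarith
  refine hrad ?_
  rcases le_total 0 η.1 with h5 | h5
  · exact Or.inl ⟨η, ⟨by rw [h4, Real.sqrt_sq h5], h3⟩, rfl⟩
  · exact Or.inr ⟨η, ⟨by rw [h4, Real.sqrt_sq_eq_abs, abs_of_nonpos h5, neg_neg], h3⟩, rfl⟩

lemma charTangential_or_charNormal {h : Metric n M} {lam : ℝ} {ξ : ScDot n 𝒞}
    (hξ : ξ ∈ dotChar 𝒞 h lam) : ξ ∈ charTangential 𝒞 h lam ∨ ξ ∈ charNormal 𝒞 h lam := by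
  obtain ⟨η, hη, rfl⟩ := hξ
  by_cases hn : piSc 𝒞 η ∈ charNormal 𝒞 h lam
  · exact Or.inr hn
  · have hs := Set.not_nontrivial_iff.1 hn
    exact Or.inl ⟨η, ⟨hη, rfl⟩, fun η' hη' => hs hη' ⟨hη, rfl⟩⟩

lemma cosphereTangential_or_cosphereNormal {h : Metric n M} {ζ : DotCotangent n 𝒞}
    (hζ : ζ ∈ dotCosphere 𝒞 h) : ζ ∈ cosphereTangential 𝒞 h ∨ ζ ∈ cosphereNormal 𝒞 h := by
  obtain ⟨η, hη, rfl⟩ := hζ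
  by_cases hn : piBdry 𝒞 η ∈ cosphereNormal 𝒞 h
  · exact Or.inr hn
  · have hs := Set.not_nontrivial_iff.1 hn
    exact Or.inl ⟨η, ⟨hη, rfl⟩, fun η' hη' => hs hη' ⟨hη, rfl⟩⟩

lemma scale_mem_cosphere {h : Metric n M} {lam : ℝ} {ξ : ScCotangent n M}
    (hξ : ξ ∈ charSet h lam) (hlt : ξ.1 ^ 2 < lam) :
    scale (normFactor lam ξ.1) ξ.2 ∈ cosphere h := by
  change metricFn h _ = 1
  rw [metricFn_scale, metricFn_of_mem_charSet hξ, sq_mul_normFactor hlt]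

lemma mem_charSet_of_mem_cosphere {h : Metric n M} {lam σ : ℝ} (hlt : σ ^ 2 < lam)
    {ζ : Cotangent n M} (hζ : ζ ∈ cosphere h) :
    ((σ, scale (normFactor lam σ)⁻¹ ζ) : ScCotangent n M) ∈ charSet h lam := by
  change σ ^ 2 + metricFn h (scale _ ζ) - lam = 0
  have h1 : metricFn h ζ = 1 := hζ
  have h2 := sq_mul_normFactor hlt
  have h3 := normFactor_pos hlt
  rw [metricFn_scale, h1, inv_pow]
  field_simp
  linarith

lemma piSc_eq_of_piBdry_eq {lam : ℝ} {ξ : ScDot n 𝒞} (hlt : ξ.tau ^ 2 < lam)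
    {ζ : Cotangent n M} (hζ : piBdry 𝒞 ζ = rescale (normFactor lam) ξ) :
    piSc 𝒞 (ξ.tau, scale (normFactor lam ξ.tau)⁻¹ ζ) = ξ := by
  refine ScDot.ext rfl ?_
  change piBdry 𝒞 (scale _ ζ) = _
  rw [piBdry_scale, hζ, rescale, DotCotangent.smul_smul', inv_mul_cancel₀ (normFactor_pos hlt).ne',
    DotCotangent.one_smul']

lemma scale_inv_injective {c : ℝ} (hc : c ≠ 0) :
    Function.Injective (scale c⁻¹ : Cotangent n M → Cotangent n M) := by
  intro ζ ζ' hζ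
  have := congrArg (scale c) hζ
  rwa [scale_scale, scale_scale, mul_inv_cancel₀ hc, scale_one, scale_one] at this

lemma mem_charTangential_of_rescale {h : Metric n M} {lam : ℝ} {ξ : ScDot n 𝒞}
    (hlt : ξ.tau ^ 2 < lam)
    (ht : rescale (normFactor lam) ξ ∈ cosphereTangential 𝒞 h) : ξ ∈ charTangential 𝒞 h lam := by
  obtain ⟨ζ, ⟨hζ, hζπ⟩, huniq⟩ := ht
  refine ⟨_, ⟨mem_charSet_of_mem_cosphere hlt hζ, piSc_eq_of_piBdry_eq hlt hζπ⟩, ?_⟩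
  rintro η ⟨hη, rfl⟩
  change η.1 ^ 2 < lam at hlt
  change η = (η.1, scale (normFactor lam η.1)⁻¹ ζ)
  rw [← huniq (scale (normFactor lam η.1) η.2) ⟨scale_mem_cosphere hη hlt, rfl⟩, scale_scale,
    inv_mul_cancel₀ (normFactor_pos hlt).ne', scale_one]

lemma mem_charNormal_of_rescale {h : Metric n M} {lam : ℝ} {ξ : ScDot n 𝒞}
    (hlt : ξ.tau ^ 2 < lam)
    (hn : rescale (normFactor lam) ξ ∈ cosphereNormal 𝒞 h) : ξ ∈ charNormal 𝒞 h lam := by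
  obtain ⟨ζ, ⟨hζ, hζπ⟩, ζ', ⟨hζ', hζπ'⟩, hne⟩ := hn
  refine ⟨_, ⟨mem_charSet_of_mem_cosphere hlt hζ, piSc_eq_of_piBdry_eq hlt hζπ⟩,
    _, ⟨mem_charSet_of_mem_cosphere hlt hζ', piSc_eq_of_piBdry_eq hlt hζπ'⟩, fun heq => hne ?_⟩
  exact scale_inv_injective (normFactor_pos hlt).ne' (congrArg Prod.snd heq)

/-! ### The Hamilton fields -/

lemma scHamilton_tau (h : Metric n M) (ξ : ScCotangent n M) :
    scHamilton h (fun ξ' => (piSc 𝒞 ξ').tau) ξ = -2 * metricFn h ξ.2 := by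
  unfold scHamilton piSc
  simp only [hamilton_const, deriv_const', deriv_id'']
  ring

/-- On functions of the normalized covector, the rescaled Hamilton field is a multiple of the
geodesic Hamilton field: the radial term and the `∂_τ` term cancel. -/
lemma scHamilton_comp_rescale {h : Metric n M} {lam : ℝ} {ξ : ScCotangent n M}
    (hξ : ξ ∈ charSet h lam) (hlt : ξ.1 ^ 2 < lam) {f : ℝ → ℝ}
    (hf : f =ᶠ[𝓝 ξ.1] normFactor lam) {u : Cotangent n M → ℝ}
    (hu : ContMDiff (cotModel n) 𝓘(ℝ, ℝ) ∞ u) :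
    scHamilton h (fun ξ' => u (scale (f ξ'.1) ξ'.2)) ξ =
      2 * √(lam - ξ.1 ^ 2) *
        hamilton (fun ζ => metricFn h ζ / 2) u (scale (normFactor lam ξ.1) ξ.2) := by
  obtain ⟨σ, η⟩ := ξ
  dsimp only at *
  set k := normFactor lam σ with hk
  have hk0 : 0 < k := normFactor_pos hlt
  have hfk : f σ = k := hf.eq_of_nhds
  let P : ℝ → ℝ := fun c => u (scale c η)
  have hP : ContDiff ℝ ∞ P := by
    rw [← contMDiff_iff_contDiff]
    exact hu.comp (contMDiff_scale.comp (contMDiff_id.prodMk contMDiff_const))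
  have hPd : HasDerivAt P (deriv P k) k := (hP.differentiable (by simp) k).hasDerivAt
  have hf' : HasDerivAt f (σ * k ^ 3) σ := (hasDerivAt_normFactor hlt).congr_of_eventuallyEq hf
  have h1 : deriv (fun r : ℝ => u (scale (f σ) (scale r η))) 1 = deriv P k * k := by
    have e1 : (fun r : ℝ => u (scale (f σ) (scale r η))) = fun r => P (k * r) := by
      funext r
      rw [scale_scale, hfk]
    rw [e1]
    have e2 : HasDerivAt (fun r : ℝ => k * r) k 1 := by
      simpa using (hasDerivAt_id (1 : ℝ)).const_mul k
    have e3 : HasDerivAt P (deriv P k) (k * 1) := by rwa [mul_one]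
    exact (e3.comp 1 e2).deriv
  have h2 : deriv (fun s : ℝ => u (scale (f s) η)) σ = deriv P k * (σ * k ^ 3) := by
    have e3 : HasDerivAt P (deriv P k) (f σ) := by rwa [hfk]
    exact (e3.comp σ hf').deriv
  have h3 : hamilton (metricFn h) (fun ζ => u (scale (f σ) ζ)) η =
      k⁻¹ * hamilton (metricFn h) u (scale k η) := by
    rw [hfk]
    exact hamilton_comp_scale hk0.ne' (metricFn_scale h k) u η
  have h4 : metricFn h η = lam - σ ^ 2 := metricFn_of_mem_charSet hξ
  have h5 : √(lam - σ ^ 2) = k⁻¹ := by rw [hk, normFactor, inv_inv]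
  have h6 := sq_mul_normFactor hlt
  unfold scHamilton
  dsimp only
  rw [h1, h2, h3, hamilton_div_two, h5, h4]
  have h7 : 2 * σ * (deriv P k * k) - 2 * (lam - σ ^ 2) * (deriv P k * (σ * k ^ 3)) = 0 := by
    linear_combination (-2 * σ * deriv P k * k) * h6
  rw [h7]
  ring

/-! ### Broken bicharacteristics and broken geodesics -/

/-- Parameters at which a curve leaves its stratum of `M` at once are isolated among those with
values in the same stratum, and there are finitely many strata. -/
lemma countable_of_leaves_regularPart (h𝒞 : IsManyBodyFamily n 𝒞) {c : ℝ → M} {N I : Set ℝ}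
    (hNI : N ⊆ I)
    (hN : ∀ t ∈ N, ∀ C ∈ 𝒞, c t ∈ regularPart 𝒞 C →
      ∃ ε > 0, ∀ t' ∈ I, 0 < |t' - t| → |t' - t| < ε → c t' ∉ regularPart 𝒞 C) :
    N.Countable := by
  have hsub : N ⊆ ⋃ C ∈ 𝒞, {t ∈ N | c t ∈ regularPart 𝒞 C} := by
    intro t ht
    have hm := minimalMember_mem h𝒞 (c t)
    exact Set.mem_biUnion hm ⟨ht, (mem_regularPart_iff h𝒞 hm _).2 rfl⟩
  refine (h𝒞.finite.countable.biUnion fun C hC => ?_).mono hsub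
  refine countable_of_forall_isolated fun t ht => ?_
  obtain ⟨ε, hε, h⟩ := hN t ht.1 C hC ht.2
  exact ⟨ε, hε, fun y hy h1 h2 => h y (hNI hy.1) h1 h2 hy.2⟩

section Bicharacteristic
variable {h : Metric n M} {lam : ℝ} {I : Set ℝ} {γ : ℝ → ScDot n 𝒞} {S : ℝ → ℝ}

lemma IsBrokenBichar.continuousOn_tau (hγ : IsBrokenBichar 𝒞 h lam I γ) :
    ContinuousOn (fun t => (γ t).tau) I :=
  continuous_tau.comp_continuousOn hγ.continuousOn

/-- The Hamilton equation for `τ` holds at all parameters, since it holds at the tangential ones and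
the others are countable. -/
lemma IsBrokenBichar.hasDerivWithinAt_tau (h𝒞 : IsManyBodyFamily n 𝒞)
    (hγ : IsBrokenBichar 𝒞 h lam I γ) {t : ℝ} (ht : t ∈ I) :
    HasDerivWithinAt (fun t => (γ t).tau) (-2 * (lam - (γ t).tau ^ 2)) I t := by
  have hc := hγ.continuousOn_tau
  refine hasDerivWithinAt_of_off_countable (N := {t ∈ I | γ t ∈ charNormal 𝒞 h lam})
    (g := fun t => -2 * (lam - (γ t).tau ^ 2)) hγ.interval hc
    (continuousOn_const.mul (continuousOn_const.sub (hc.pow 2))) ?_ ?_ ht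
  · exact countable_of_leaves_regularPart h𝒞 (c := fun t => (γ t).fib.base) (I := I)
      (fun t ht => ht.1) fun t ht C hC => hγ.normal t ht.1 ht.2 C hC
  · rintro t ⟨htI, htN⟩
    have htan : γ t ∈ charTangential 𝒞 h lam :=
      (charTangential_or_charNormal (hγ.mapsTo htI)).resolve_right fun hn => htN ⟨htI, hn⟩
    obtain ⟨ξ, ⟨hξ, hξγ⟩, -⟩ := id htan
    have h1 := hγ.tangential t htI htan ScDot.tau contMDiff_fst ξ hξ hξγ
    rw [scHamilton_tau, metricFn_of_mem_charSet hξ] at h1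
    have h2 : ξ.1 = (γ t).tau := congrArg ScDot.tau hξγ
    rwa [h2] at h1

omit [IsManifold (𝓡 n) ∞ M] in
lemma IsReparam.continuousOn (hS : IsReparam lam I γ S) : ContinuousOn S I :=
  fun t ht => (hS t ht).continuousWithinAt

omit [IsManifold (𝓡 n) ∞ M] in
lemma IsReparam.strictMonoOn (hI : I.OrdConnected) (hlt : ∀ t ∈ I, (γ t).tau ^ 2 < lam)
    (hS : IsReparam lam I γ S) : StrictMonoOn S I := by
  refine strictMonoOn_of_hasDerivWithinAt_pos hI.convex hS.continuousOn
    (fun t ht => (hS t (interior_subset ht)).mono interior_subset) fun t ht => ?_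
  have h1 := hlt t (interior_subset ht)
  have h2 : 0 < √(lam - (γ t).tau ^ 2) := Real.sqrt_pos.2 (by linarith)
  positivity

lemma isReparam_arccos (h𝒞 : IsManyBodyFamily n 𝒞) (hγ : IsBrokenBichar 𝒞 h lam I γ)
    (hlt : ∀ t ∈ I, (γ t).tau ^ 2 < lam) (a : ℝ) :
    IsReparam lam I γ (fun t => a + Real.arccos ((γ t).tau / √lam)) := fun t ht =>
  (hasDerivWithinAt_arccos_tau (τ := fun t => (γ t).tau) (hlt t ht)
    (hγ.hasDerivWithinAt_tau h𝒞 ht)).const_add a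

lemma IsReparam.exists_eq_arccos (h𝒞 : IsManyBodyFamily n 𝒞) (hγ : IsBrokenBichar 𝒞 h lam I γ)
    (hlt : ∀ t ∈ I, (γ t).tau ^ 2 < lam) (hS : IsReparam lam I γ S) :
    ∃ s₁, ∀ t ∈ I, S t - s₁ = Real.arccos ((γ t).tau / √lam) := by
  rcases I.eq_empty_or_nonempty with rfl | ⟨t₀, ht₀⟩
  · exact ⟨0, fun t ht => ht.elim⟩
  refine ⟨S t₀ - Real.arccos ((γ t₀).tau / √lam), fun t ht => ?_⟩
  have hz : ∀ t ∈ I, HasDerivWithinAt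
      (fun t => S t - (0 + Real.arccos ((γ t).tau / √lam))) 0 I t := fun t ht =>
    ((hS t ht).sub (isReparam_arccos h𝒞 hγ hlt 0 t ht)).congr_deriv (sub_self _)
  have h1 := eq_of_hasDerivWithinAt_zero hγ.interval hz ht ht₀
  linarith

/-- Along the reparametrized bicharacteristic the normalized fibre variable is a generalized broken
geodesic. -/
lemma isBrokenGeodesic_rescale (hγ : IsBrokenBichar 𝒞 h lam I γ)
    (hlt : ∀ t ∈ I, (γ t).tau ^ 2 < lam) (hS : IsReparam lam I γ S) :
    IsBrokenGeodesic 𝒞 h (S '' I)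
      (fun s => rescale (normFactor lam) (γ (Function.invFunOn S I s))) := by
  have hm := hS.strictMonoOn hγ.interval hlt
  set T := Function.invFunOn S I with hT
  have hTI : ∀ s ∈ S '' I, T s ∈ I := fun s hs => Function.invFunOn_mem hs
  have hST : ∀ s ∈ S '' I, S (T s) = s := fun s hs => Function.invFunOn_eq hs
  have hTc : ContinuousOn T (S '' I) := continuousOn_invFunOn hγ.interval hm hS.continuousOn
  have hγT : ContinuousOn (fun s => γ (T s)) (S '' I) := hγ.continuousOn.comp hTc hTI
  -- Near each parameter the normalizing factor may be replaced by a smooth function.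
  have hloc : ∀ s ∈ S '' I, ∃ f : ℝ → ℝ, ContDiff ℝ ∞ f ∧
      f =ᶠ[𝓝 (γ (T s)).tau] normFactor lam ∧
      ∀ᶠ s' in 𝓝[S '' I] s, rescale (normFactor lam) (γ (T s')) = rescale f (γ (T s')) := by
    intro s hs
    obtain ⟨f, hf, hfk⟩ := exists_contDiff_eq_normFactor (hlt _ (hTI s hs))
    refine ⟨f, hf, hfk, ?_⟩
    have h1 : ContinuousWithinAt (fun s => (γ (T s)).tau) (S '' I) s :=
      continuous_tau.continuousAt.comp_continuousWithinAt (hγT s hs)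
    filter_upwards [h1.eventually hfk] with s' hs'
    unfold rescale
    rw [hs']
  refine ⟨ordConnected_image hγ.interval hS.continuousOn, ?_, ?_, ?_, ?_⟩
  · intro s hs
    obtain ⟨ξ, hξ, hξγ⟩ := hγ.mapsTo (hTI s hs)
    have h1 := hlt _ (hTI s hs)
    rw [← hξγ] at h1
    refine ⟨_, scale_mem_cosphere hξ h1, ?_⟩
    dsimp only
    rw [← hξγ]
    rfl
  · intro s hs
    obtain ⟨f, hf, -, hev⟩ := hloc s hs
    exact ((continuous_rescale hf.continuous).continuousAt.comp_continuousWithinAt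
      (hγT s hs)).congr_of_eventuallyEq hev (hev.self_of_nhdsWithin hs)
  · intro s hs htan F hF ζ hζ hζγ
    obtain ⟨f, hf, hfk, hev⟩ := hloc s hs
    have hlts := hlt _ (hTI s hs)
    have htan' := mem_charTangential_of_rescale hlts htan
    have hξπ := piSc_eq_of_piBdry_eq hlts hζγ
    have hξ := mem_charSet_of_mem_cosphere (h := h) hlts hζ
    have h1 := hγ.tangential (T s) (hTI s hs) htan' (fun ξ => F (rescale f ξ))
      (hF.comp (contMDiff_scale_comp hf)) _ hξ hξπ
    have h2 := scHamilton_comp_rescale hξ hlts hfk hF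
    have h3 := hasDerivWithinAt_invFunOn hγ.interval hm hS.continuousOn (hTI s hs)
      (a := 2 * √(lam - (γ (T s)).tau ^ 2))
      (mul_pos two_pos (Real.sqrt_pos.2 (by linarith))).ne' (hS _ (hTI s hs))
    rw [hST s hs] at h3
    have h4 := h1.comp s h3 hTI
    refine (h4.congr_of_eventuallyEq (hev.mono fun s' hs' => congrArg F hs')
      (congrArg F (hev.self_of_nhdsWithin hs))).congr_deriv ?_
    have h5 : scHamilton h (fun ξ' => F (rescale f (piSc 𝒞 ξ')))
        ((γ (T s)).tau, scale (normFactor lam (γ (T s)).tau)⁻¹ ζ) = _ := h2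
    have h6 : 0 < √(lam - (γ (T s)).tau ^ 2) := Real.sqrt_pos.2 (by linarith)
    rw [h5]
    dsimp only
    rw [scale_scale, mul_inv_cancel₀ (normFactor_pos hlts).ne', scale_one]
    field_simp
  · intro s hs hn C hC hb
    obtain ⟨ε, hε, hleave⟩ := hγ.normal (T s) (hTI s hs)
      (mem_charNormal_of_rescale (hlt _ (hTI s hs)) hn) C hC hb
    obtain ⟨δ, hδ, hclose⟩ := Metric.continuousWithinAt_iff.1 (hTc s hs) ε hε
    refine ⟨δ, hδ, fun s' hs' h1 h2 => hleave (T s') (hTI s' hs') ?_ (hclose hs' h2)⟩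
    refine abs_pos.2 (sub_ne_zero.2 fun heq => ?_)
    have : s' = s := by rw [← hST s' hs', heq, hST s hs]
    rw [this, sub_self, abs_zero] at h1
    exact h1.false

/-- A bicharacteristic defined on the whole line runs from one radial set to the other. -/
lemma image_eq_Ioo_of_univ (h𝒞 : IsManyBodyFamily n 𝒞) (hγ : IsBrokenBichar 𝒞 h lam Set.univ γ)
    (hlt : ∀ t, (γ t).tau ^ 2 < lam) {s₁ : ℝ}
    (hS : ∀ t, S t - s₁ = Real.arccos ((γ t).tau / √lam)) :
    S '' Set.univ = Set.Ioo s₁ (s₁ + Real.pi) := by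
  have hlam : 0 < lam := (sq_nonneg _).trans_lt (hlt 0)
  have hr : 0 < √lam := Real.sqrt_pos.2 hlam
  apply Set.Subset.antisymm
  · rintro _ ⟨t, -, rfl⟩
    have h1 := (sqrt_mul_cos_arccos (hlt t)).2.2
    rw [← hS t] at h1
    exact ⟨by linarith [h1.1], by linarith [h1.2]⟩
  · intro s hs
    have hs' : s - s₁ ∈ Set.Ioo 0 Real.pi := ⟨by linarith [hs.1], by linarith [hs.2]⟩
    have hcos : |Real.cos (s - s₁)| < 1 := by
      have h1 := Real.sin_pos_of_mem_Ioo hs'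
      rw [← sq_lt_one_iff_abs_lt_one]
      nlinarith [Real.sin_sq_add_cos_sq (s - s₁)]
    have hcos' := abs_lt.1 hcos
    obtain ⟨t, ht⟩ := exists_tau_eq (τ := fun t => (γ t).tau) (r := √lam)
      (y := √lam * Real.cos (s - s₁))
      (fun t => by
        rw [Real.sq_sqrt hlam.le]
        exact hasDerivWithinAt_univ.1 (hγ.hasDerivWithinAt_tau h𝒞 (Set.mem_univ t)))
      (fun t => abs_lt.1 (Real.lt_sqrt_of_sq_lt (by rw [sq_abs]; exact hlt t)))
      ⟨by nlinarith, by nlinarith⟩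
    refine ⟨t, Set.mem_univ t, ?_⟩
    have h1 := hS t
    rw [ht, mul_div_cancel_left₀ _ hr.ne', Real.arccos_cos hs'.1.le hs'.2.le] at h1
    linarith

end Bicharacteristic

section Geodesic
variable {h : Metric n M} {J : Set ℝ} {γ : ℝ → DotCotangent n 𝒞}

/-- At a tangential interior parameter the base curve of a broken geodesic has a velocity, and it is
a unit vector. -/
lemma IsBrokenGeodesic.exists_unit_velocity [T2Space M] (hγ : IsBrokenGeodesic 𝒞 h J γ)
    {s : ℝ} (hs : J ∈ 𝓝 s) (htan : γ s ∈ cosphereTangential 𝒞 h) :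
    ∃ v : TangentSpace (𝓡 n) (γ s).base, h.inner (γ s).base v v = 1 ∧
      HasMFDerivAt 𝓘(ℝ, ℝ) (𝓡 n) (fun s => (γ s).base) s
        (ContinuousLinearMap.toSpanSingleton ℝ v) := by
  have hsJ := mem_of_mem_nhds hs
  obtain ⟨ζ, ⟨hζ, hζγ⟩, -⟩ := id htan
  have hbase : ζ.proj = (γ s).base := congrArg DotCotangent.base hζγ
  have key : ∃ v : TangentSpace (𝓡 n) ζ.proj, h.inner ζ.proj v v = 1 ∧
      ∀ f : M → ℝ, ContMDiff (𝓡 n) 𝓘(ℝ, ℝ) ∞ f →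
        HasDerivAt (fun t => f (γ t).base) (mfderiv (𝓡 n) 𝓘(ℝ, ℝ) f ζ.proj v) s := by
    refine ⟨sharp h ζ, ?_, fun f hf => ?_⟩
    · rw [inner_sharp]
      exact hζ
    · rw [← hamilton_comp_proj h ζ hf]
      exact (hγ.tangential s hsJ htan (fun ζ => f ζ.base)
        (hf.comp (contMDiff_proj _)) ζ hζ hζγ).hasDerivAt hs
  rw [hbase] at key
  obtain ⟨v, hv, hf⟩ := key
  refine ⟨v, hv, hasMFDerivAt_of_forall_smooth ?_ v hf⟩
  exact DotCotangent.continuous_base.continuousAt.comp (hγ.continuousOn.continuousAt hs)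

/-- A broken geodesic is parametrized by arc length. -/
lemma IsBrokenGeodesic.curveLength_eq [T2Space M] (h𝒞 : IsManyBodyFamily n 𝒞) {a b : ℝ}
    (hγ : IsBrokenGeodesic 𝒞 h (Set.Ioo a b) γ) :
    (∃ N : Set ℝ, N.Countable ∧ ∀ s ∈ Set.Ioo a b \ N,
      MDifferentiableAt 𝓘(ℝ, ℝ) (𝓡 n) (fun s => (γ s).base) s) ∧
    curveLength h (fun s => (γ s).base) a b = ENNReal.ofReal (b - a) := by
  let N : Set ℝ := {s ∈ Set.Ioo a b | γ s ∈ cosphereNormal 𝒞 h}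
  have hN : N.Countable :=
    countable_of_leaves_regularPart h𝒞 (c := fun s => (γ s).base) (I := Set.Ioo a b)
      (fun s hs => hs.1) fun s hs C hC => hγ.normal s hs.1 hs.2 C hC
  have hv : ∀ s ∈ Set.Ioo a b \ N, ∃ v : TangentSpace (𝓡 n) (γ s).base,
      h.inner (γ s).base v v = 1 ∧ HasMFDerivAt 𝓘(ℝ, ℝ) (𝓡 n) (fun s => (γ s).base) s
        (ContinuousLinearMap.toSpanSingleton ℝ v) := fun s hs =>
    hγ.exists_unit_velocity (isOpen_Ioo.mem_nhds hs.1)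
      ((cosphereTangential_or_cosphereNormal (hγ.mapsTo hs.1)).resolve_right
        fun hn => hs.2 ⟨hs.1, hn⟩)
  refine ⟨⟨N, hN, fun s hs => ?_⟩, ?_⟩
  · obtain ⟨v, -, hd⟩ := hv s hs
    exact hd.mdifferentiableAt
  · have hae : ∀ᵐ s ∂MeasureTheory.volume.restrict (Set.Ioo a b),
        ENNReal.ofReal (√(h.inner (γ s).base (velocity (n := n) (fun s => (γ s).base) s)
          (velocity (n := n) (fun s => (γ s).base) s))) = 1 := by
      filter_upwards [MeasureTheory.ae_restrict_mem measurableSet_Ioo,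
        MeasureTheory.ae_restrict_of_ae (hN.ae_notMem _)] with s hs hsN
      obtain ⟨v, hv1, hd⟩ := hv s ⟨hs, hsN⟩
      have h1 : velocity (n := n) (fun s => (γ s).base) s = v := by
        unfold velocity
        rw [hd.mfderiv]
        exact one_smul ℝ v
      rw [h1, hv1, Real.sqrt_one, ENNReal.ofReal_one]
    unfold curveLength
    rw [MeasureTheory.lintegral_congr_ae hae]
    simp

end Geodesic

end BrokenBichar

end

theorem mainTheorem7 {n : ℕ} {M : Type u} [TopologicalSpace M] [T2Space M] [CompactSpace M]
    [ChartedSpace (EuclideanSpace ℝ (Fin n)) M] [IsManifold (𝓡 n) ∞ M]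
    (𝒞 : Set (Set M)) (h𝒞 : BrokenBichar.IsManyBodyFamily n 𝒞)
    (hlin : BrokenBichar.LocallyLinearizable n 𝒞)
    (h : BrokenBichar.Metric n M) (lam : ℝ) (hlam : 0 < lam)
    (I : Set ℝ) (γ : ℝ → BrokenBichar.ScDot n 𝒞)
    (hγ : BrokenBichar.IsBrokenBichar 𝒞 h lam I γ)
    (hrad : ∀ t ∈ I, γ t ∉ BrokenBichar.radialPlus 𝒞 h lam ∪ BrokenBichar.radialMinus 𝒞 h lam) :
    (∀ t₀ ∈ I, ∀ s₀ : ℝ, ∃ S : ℝ → ℝ, BrokenBichar.IsReparam lam I γ S ∧ S t₀ = s₀) ∧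
    ∀ S : ℝ → ℝ, BrokenBichar.IsReparam lam I γ S →
      StrictMonoOn S I ∧
      ∃ (s₁ : ℝ) (γb : ℝ → BrokenBichar.DotCotangent n 𝒞),
        BrokenBichar.IsBrokenGeodesic 𝒞 h (S '' I) γb ∧
        S '' I ⊆ Set.Ioo s₁ (s₁ + Real.pi) ∧
        (∀ t ∈ I, (γ t).tau = √lam * Real.cos (S t - s₁) ∧
          (γ t).fib = (√lam * Real.sin (S t - s₁)) • γb (S t)) ∧
        (I = Set.univ →
          S '' I = Set.Ioo s₁ (s₁ + Real.pi) ∧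
          (∃ N : Set ℝ, N.Countable ∧ ∀ s ∈ Set.Ioo s₁ (s₁ + Real.pi) \ N,
            MDifferentiableAt 𝓘(ℝ, ℝ) (𝓡 n) (fun s' => (γb s').base) s) ∧
          BrokenBichar.curveLength h (fun s' => (γb s').base) s₁ (s₁ + Real.pi)
            = ENNReal.ofReal Real.pi) := by
  have hlt : ∀ t ∈ I, (γ t).tau ^ 2 < lam := fun t ht =>
    BrokenBichar.tau_sq_lt (hγ.mapsTo ht) (hrad t ht)
  refine ⟨fun t₀ _ s₀ => ⟨_, BrokenBichar.isReparam_arccos h𝒞 hγ hlt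
    (s₀ - Real.arccos ((γ t₀).tau / √lam)), sub_add_cancel _ _⟩, fun S hS => ?_⟩
  have hm := hS.strictMonoOn hγ.interval hlt
  obtain ⟨s₁, hs₁⟩ := hS.exists_eq_arccos h𝒞 hγ hlt
  have hgeo := BrokenBichar.isBrokenGeodesic_rescale hγ hlt hS
  refine ⟨hm, s₁, _, hgeo, ?_, fun t ht => ?_, ?_⟩
  · rintro _ ⟨t, ht, rfl⟩
    have h1 := (BrokenBichar.sqrt_mul_cos_arccos (hlt t ht)).2.2
    rw [← hs₁ t ht] at h1
    exact ⟨by linarith [h1.1], by linarith [h1.2]⟩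
  · obtain ⟨h1, h2, -⟩ := BrokenBichar.sqrt_mul_cos_arccos (hlt t ht)
    have hT : Function.invFunOn S I (S t) = t :=
      hm.injOn (Function.invFunOn_mem ⟨t, ht, rfl⟩) ht (Function.invFunOn_eq ⟨t, ht, rfl⟩)
    have h3 : 0 < √(lam - (γ t).tau ^ 2) := Real.sqrt_pos.2 (by linarith [hlt t ht])
    refine ⟨by rw [hs₁ t ht, h1], ?_⟩
    rw [hs₁ t ht, h2, hT, BrokenBichar.rescale, BrokenBichar.DotCotangent.smul_smul',
      BrokenBichar.normFactor, mul_inv_cancel₀ h3.ne', BrokenBichar.DotCotangent.one_smul']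
  · rintro rfl
    have hJ := BrokenBichar.image_eq_Ioo_of_univ h𝒞 hγ (fun t => hlt t (Set.mem_univ t))
      (fun t => hs₁ t (Set.mem_univ t))
    rw [hJ] at hgeo
    obtain ⟨h1, h2⟩ := hgeo.curveLength_eq h𝒞
    refine ⟨hJ, h1, h2.trans ?_⟩
    rw [add_sub_cancel_left]
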